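/- Let $a,b,c\in\mathbb R$ with either $c=0$ and $a\ne b$, or $c>0$ and $a<b$. Put $Q(x)=ax(x-1)+bx+c$ and, for $\nu\ge 0$, $$N_\nu(z)=az^2J_\nu''(z)+bzJ_\nu'(z)+cJ_\nu(z),$$ where $J_\nu$ is the Bessel function of the first kind. Let $\nu\ge\max\{0,\nu_0\}$, where $\nu_0$ is the largest real root of $Q$ (if $Q$ has no real root, this means $\nu\ge 0$), and assume $Q(\nu)\neq 0$. Consider the analytic functions, normalized by $f(0)=0$, $f'(0)=1$ near the origin, that are given by $$f_\nu(z)=\Big[\tfrac{2^\nu\Gamma(\nu+1)}{Q(\nu)}N_\nu(z)\Big]^{1/\nu}\ (\nu\ne0),\qquad g_\nu(z)=\tfrac{2^\nu\Gamma(\nu+1)z^{1-\nu}}{Q(\nu)}N_\nu(z),\qquad h_\nu(z)=\tfrac{2^\nu\Gamma(\nu+1)z^{1-\nu/2}}{Q(\nu)}N_\nu(\sqrt z),$$ the powers being the positive real ones for small $z>0$. Let $\varphi$ be a Ma–Minda function, i.e. analytic and univalent in $\mathbb D=\{|z|<1\}$ with $\operatorname{Re}\varphi>0$, $\varphi'(0)>0$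 and $\varphi(\mathbb D)$ starlike with respect to $\varphi(0)=1$ and symmetric about the real axis. Let $\beta$ be the radius of the largest disk $\{w:|w-1|<\beta\}$ contained in $\varphi(\mathbb D)$, and suppose that $\varphi(-1)=1-\beta$, where $\varphi(-1)=\lim_{t\downarrow-1}\varphi(t)$ is the radial boundary value. The $\mathcal S^*(\varphi)$-radius of $f$ is the supremum of all $r>0$ such that $f$ is analytic in $|z|<r$ and $zf'(z)/f(z)\in\varphi(\mathbb D)$ for all $|z|<r$ (with the value $1$ at $z=0$). Then $N_\nu$ has a smallest positive zero $\lambda_{\nu,1}$, and the $\mathcal S^*(\varphi)$-radii of $f_\nu$ (for $\nu\neq0$), $g_\nu$ and $h_\nu$ are, respectively, the smallest positive roots of the equations (a) $rN_\nu'(r)-(1-\beta)\nu N_\nu(r)=0$ $(\nu\ne0)$; (b) $rN_\nu'(r)-(\nu-\beta)N_\nu(r)=0$; (c) $\sqrt r\,N_\nu'(\sqrt r)-(\nu-2\beta)N_\nu(\sqrt r)=0$. These roots exist and lie in $(0,\lambda_{\nu,1})$, $(0,\lambda_{\nu,1})$ and $(0,\lambda_{\nu,1}^2)$, respectively. -/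

import Mathlib

open Filter Topology

noncomputable section

/-- The Bessel function of the first kind of real order `ν`, with principal powers:
`J_ν(z) = ∑ (-1)^n / (n! Γ(n+ν+1)) (z/2)^(2n+ν)`. -/
def besselJ (ν : ℝ) (z : ℂ) : ℂ :=
  ∑' n : ℕ, ((-1 : ℂ) ^ n / ((n.factorial : ℂ) * (Real.Gamma (n + ν + 1) : ℂ))) *
    (z / 2) ^ (2 * (n : ℂ) + (ν : ℂ))

/-- `N_ν(z) = a z² J_ν''(z) + b z J_ν'(z) + c J_ν(z)`. -/
def besselN (a b c ν : ℝ) (z : ℂ) : ℂ :=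
  a * z ^ 2 * deriv (deriv (besselJ ν)) z + b * z * deriv (besselJ ν) z + c * besselJ ν z

/-- `Q(x) = a x (x - 1) + b x + c`. -/
def besselQ (a b c x : ℝ) : ℝ := a * x * (x - 1) + b * x + c

/-- The formula `[2^ν Γ(ν+1) / Q(ν) · N_ν(z)]^(1/ν)` (principal power). -/
def fNormal (a b c ν : ℝ) (z : ℂ) : ℂ :=
  ((2 : ℂ) ^ (ν : ℂ) * (Real.Gamma (ν + 1) : ℂ) / (besselQ a b c ν : ℂ) * besselN a b c ν z) ^
    (1 / (ν : ℂ))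

/-- The formula `2^ν Γ(ν+1) z^(1-ν) / Q(ν) · N_ν(z)` (principal powers). -/
def gNormal (a b c ν : ℝ) (z : ℂ) : ℂ :=
  (2 : ℂ) ^ (ν : ℂ) * (Real.Gamma (ν + 1) : ℂ) * z ^ (1 - (ν : ℂ)) / (besselQ a b c ν : ℂ) *
    besselN a b c ν z

/-- The formula `2^ν Γ(ν+1) z^(1-ν/2) / Q(ν) · N_ν(√z)` (principal powers). -/
def hNormal (a b c ν : ℝ) (z : ℂ) : ℂ :=
  (2 : ℂ) ^ (ν : ℂ) * (Real.Gamma (ν + 1) : ℂ) * z ^ (1 - (ν : ℂ) / 2) / (besselQ a b c ν : ℂ) *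
    besselN a b c ν (z ^ (1 / 2 : ℂ))

/-- Ma–Minda functions: analytic and univalent in the unit disk, with positive real part,
`φ'(0) > 0`, and image starlike with respect to `φ(0) = 1` and symmetric about the real axis. -/
structure IsMaMinda (φ : ℂ → ℂ) : Prop where
  analytic : DifferentiableOn ℂ φ (Metric.ball 0 1)
  univalent : Set.InjOn φ (Metric.ball 0 1)
  re_pos : ∀ z ∈ Metric.ball (0 : ℂ) 1, 0 < (φ z).re
  map_zero : φ 0 = 1
  deriv_re_pos : 0 < (deriv φ 0).re
  deriv_im_zero : (deriv φ 0).im = 0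
  starlike : StarConvex ℝ 1 (φ '' Metric.ball 0 1)
  symmetric : ∀ w ∈ φ '' Metric.ball 0 1, starRingEnd ℂ w ∈ φ '' Metric.ball 0 1

/-- `F` is the normalized (`F(0) = 0`, `F'(0) = 1`) analytic function in the disk `|z| < r` given
by the formula `f`. The formula may involve multivalued powers of `z`; for small `x > 0` these are
the usual positive real powers, and the values there determine `F` by the identity theorem. -/
structure IsNormalizedOn (f F : ℂ → ℂ) (r : ℝ) : Prop where
  analytic : DifferentiableOn ℂ F (Metric.ball 0 r)
  map_zero : F 0 = 0
  deriv_zero : deriv F 0 = 1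
  eq_formula : ∀ᶠ x : ℝ in 𝓝[>] 0, F x = f x

/-- `z F'(z) / F(z) ∈ φ(𝔻)` for all `|z| < r`. At `z = 0` the quotient has the removable value
`1 = φ(0)`, so nothing has to be required there. -/
def IsStarOn (φ F : ℂ → ℂ) (r : ℝ) : Prop :=
  ∀ z ∈ Metric.ball (0 : ℂ) r, z ≠ 0 →
    F z ≠ 0 ∧ z * deriv F z / F z ∈ φ '' Metric.ball 0 1

/-- `R` is the `S*(φ)`-radius of the function given by the formula `f`: the supremum of all
`r > 0` such that the function is analytic in `|z| < r` with `z f'(z) / f(z) ∈ φ(𝔻)` there. -/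
def IsStarRadius (φ f : ℂ → ℂ) (R : ℝ) : Prop :=
  IsLUB {r : ℝ | 0 < r ∧ ∃ F : ℂ → ℂ, IsNormalizedOn f F r ∧ IsStarOn φ F r} R

end

/-! Write `N_ν(z) = Q(ν)/Γ(ν+1) · (z/2)^ν v(z²)` with `v` entire and `v(0) = 1`, and put `S =
-2wv'/v`. The quotient `zF'/F` is then `1 - S(z²)/ν` for `f_ν`, `1 - S(z²)` for `g_ν` and `1 -
S(z)/2` for `h_ν`. Everything follows from one fact: the Taylor coefficients of `S` are nonnegative,
and those of positive index grow at least geometrically. Neither a Hadamard product nor the reality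
of all zeros of `N_ν` is needed.

For `J_ν` itself this fact is read off from the Riccati equation equivalent to Bessel's equation
(`exists_logDeriv_besselSeries`). The passage from `J_ν` to `N_ν` multiplies the series by one or
two factors `1 - G`, where `G` has nonnegative coefficients and no constant term; each factor only
increases the coefficients of `S` (`exists_logDeriv_mul_one_sub`, `exists_logDeriv_besselNSeries`).

Geometric growth forces `v` to have a zero, and nonnegativity places a zero of smallest modulus at a
positive `x₀` (`exists_first_zero`). On `[0, x₀)` the function `S` increases from `0` and is
unbounded, while `|S(w)| ≤ S(|w|)`; so every `t > 0` equals `S(x)` for some `x < x₀`, with `|S| < t`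
on `|w| < x` (`exists_logDeriv_eq`). Taking `t = βν`, `β`, `2β` keeps `zF'/F` in the disk of radius
`β` about `1` up to the claimed radius, where it takes the value `1 - β`. This value is a radial
boundary value of the univalent `φ`, hence is not attained (`radial_limit_not_mem_image`), so no
larger radius works (`isStarRadius_of_exp`). -/

noncomputable section

/-! ### Formal power series, their sums, and the Euler operator -/

/-- The sum `∑ pₙ wⁿ` of a formal power series at a point. -/
def psSum (P : PowerSeries ℂ) (w : ℂ) : ℂ := ∑' n, PowerSeries.coeff n P * w ^ n

/-- Absolute convergence of a formal power series in the open disk of radius `ρ`. -/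
def PsConv (P : PowerSeries ℂ) (ρ : ℝ) : Prop :=
  ∀ x : ℝ, 0 ≤ x → x < ρ → Summable fun n => ‖PowerSeries.coeff n P‖ * x ^ n

/-- The Euler operator `X d/dX` on formal power series. -/
def psEuler {R : Type*} [CommRing R] (P : PowerSeries R) : PowerSeries R :=
  PowerSeries.X * PowerSeries.derivative R P

theorem coeff_psEuler {R : Type*} [CommRing R] (P : PowerSeries R) (n : ℕ) :
    PowerSeries.coeff n (psEuler P) = n * PowerSeries.coeff n P := by
  unfold psEuler
  cases n with
  | zero => simp
  | succ k =>
    rw [PowerSeries.coeff_succ_X_mul, PowerSeries.coeff_derivative]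
    push_cast; ring

theorem psEuler_add {R : Type*} [CommRing R] (P Q : PowerSeries R) :
    psEuler (P + Q) = psEuler P + psEuler Q := by
  simp [psEuler, mul_add]

theorem psEuler_sub {R : Type*} [CommRing R] (P Q : PowerSeries R) :
    psEuler (P - Q) = psEuler P - psEuler Q := by
  simp [psEuler, mul_sub]

theorem psEuler_neg {R : Type*} [CommRing R] (P : PowerSeries R) :
    psEuler (-P) = -psEuler P := by
  simp [psEuler]

theorem psEuler_mul {R : Type*} [CommRing R] (P Q : PowerSeries R) :
    psEuler (P * Q) = psEuler P * Q + P * psEuler Q := by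
  simp only [psEuler, Derivation.leibniz, smul_eq_mul]
  ring

theorem psEuler_one {R : Type*} [CommRing R] : psEuler (1 : PowerSeries R) = 0 := by
  ext n
  rw [coeff_psEuler, PowerSeries.coeff_one]
  split_ifs with h <;> simp [h]

theorem hasSum_congr_terms {f g : ℕ → ℂ} {a : ℂ} (h : HasSum f a) (hfg : ∀ n, g n = f n) :
    HasSum g a := by
  rwa [funext hfg]

namespace PsConv

variable {P Q : PowerSeries ℂ} {ρ : ℝ} {w : ℂ}

theorem summable_norm (h : PsConv P ρ) (hw : ‖w‖ < ρ) :
    Summable fun n => ‖PowerSeries.coeff n P * w ^ n‖ := by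
  simpa only [norm_mul, norm_pow] using h ‖w‖ (norm_nonneg _) hw

theorem hasSum (h : PsConv P ρ) (hw : ‖w‖ < ρ) :
    HasSum (fun n => PowerSeries.coeff n P * w ^ n) (psSum P w) :=
  (h.summable_norm hw).of_norm.hasSum

theorem of_le (h : PsConv P ρ)
    (hPQ : ∀ n, ‖PowerSeries.coeff n Q‖ ≤ ‖PowerSeries.coeff n P‖) : PsConv Q ρ := by
  intro x hx hx'
  exact Summable.of_nonneg_of_le (fun n => by positivity)
    (fun n => mul_le_mul_of_nonneg_right (hPQ n) (by positivity)) (h x hx hx')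

theorem differentiableOn_and_hasSum_deriv (h : PsConv P ρ) (hw : ‖w‖ < ρ) :
    DifferentiableAt ℂ (psSum P) w ∧
      HasSum (fun n => PowerSeries.coeff n P * (n * w ^ (n - 1))) (deriv (psSum P) w) := by
  obtain ⟨x, hx, hxρ⟩ := exists_between hw
  have hx0 : 0 ≤ x := (norm_nonneg _).trans hx.le
  have hmem : w ∈ Metric.ball (0 : ℂ) x := by simpa using hx
  have hd : ∀ n : ℕ, DifferentiableOn ℂ (fun w : ℂ => PowerSeries.coeff n P * w ^ n)
      (Metric.ball 0 x) := fun n => by fun_prop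
  have hle : ∀ (n : ℕ) (z : ℂ), z ∈ Metric.ball (0 : ℂ) x →
      ‖PowerSeries.coeff n P * z ^ n‖ ≤ ‖PowerSeries.coeff n P‖ * x ^ n := by
    intro n z hz
    rw [norm_mul, norm_pow]
    have : ‖z‖ ≤ x := by simpa using (mem_ball_zero_iff.1 hz).le
    gcongr
  refine ⟨(Complex.differentiableOn_tsum_of_summable_norm (h x hx0 hxρ) hd Metric.isOpen_ball
    hle).differentiableAt (Metric.isOpen_ball.mem_nhds hmem), ?_⟩
  have := Complex.hasSum_deriv_of_summable_norm (h x hx0 hxρ) hd Metric.isOpen_ball hle hmem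
  simp only [deriv_const_mul_field', deriv_pow_field] at this
  exact this

theorem differentiableAt (h : PsConv P ρ) (hw : ‖w‖ < ρ) : DifferentiableAt ℂ (psSum P) w :=
  (h.differentiableOn_and_hasSum_deriv hw).1

theorem differentiableOn (h : PsConv P ρ) : DifferentiableOn ℂ (psSum P) (Metric.ball 0 ρ) :=
  fun _ hw => (h.differentiableAt (mem_ball_zero_iff.1 hw)).differentiableWithinAt

theorem hasSum_euler (h : PsConv P ρ) (hw : ‖w‖ < ρ) :
    HasSum (fun n => PowerSeries.coeff n (psEuler P) * w ^ n) (w * deriv (psSum P) w) := by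
  refine hasSum_congr_terms ((h.differentiableOn_and_hasSum_deriv hw).2.mul_left w) fun n => ?_
  rw [coeff_psEuler]
  cases n with
  | zero => simp
  | succ k => simp only [Nat.add_sub_cancel, pow_succ]; ring

theorem psSum_euler (h : PsConv P ρ) (hw : ‖w‖ < ρ) :
    psSum (psEuler P) w = w * deriv (psSum P) w :=
  (h.hasSum_euler hw).tsum_eq

theorem euler (h : PsConv P ρ) : PsConv (psEuler P) ρ := by
  intro x hx hx'
  -- Replacing the coefficients by their absolute values turns absolute convergence of the derived
  -- series at `x` into its plain convergence there.
  have h' : PsConv (PowerSeries.mk fun n => ((‖PowerSeries.coeff n P‖ : ℝ) : ℂ)) ρ :=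
    h.of_le fun n => by simp
  have hs := (h'.hasSum_euler (w := x) (by simpa [abs_of_nonneg hx] using hx')).summable.norm
  refine hs.congr fun n => ?_
  simp [coeff_psEuler, abs_of_nonneg hx]

theorem mul (hP : PsConv P ρ) (hQ : PsConv Q ρ) : PsConv (P * Q) ρ := by
  intro x hx hx'
  have hx'' : ‖(x : ℂ)‖ < ρ := by simpa [abs_of_nonneg hx] using hx'
  have := summable_norm_sum_mul_antidiagonal_of_summable_norm (hP.summable_norm hx'')
    (hQ.summable_norm hx'')
  refine this.congr fun n => ?_
  have hn : ∑ kl ∈ Finset.HasAntidiagonal.antidiagonal n,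
      PowerSeries.coeff kl.1 P * (x : ℂ) ^ kl.1 * (PowerSeries.coeff kl.2 Q * (x : ℂ) ^ kl.2) = PowerSeries.coeff n (P * Q) * (x : ℂ) ^ n := by
    rw [PowerSeries.coeff_mul, Finset.sum_mul]
    refine Finset.sum_congr rfl fun kl hkl => ?_
    rw [← Finset.HasAntidiagonal.mem_antidiagonal.1 hkl, pow_add]; ring
  rw [hn, norm_mul, norm_pow]
  simp [abs_of_nonneg hx]

theorem psSum_mul (hP : PsConv P ρ) (hQ : PsConv Q ρ) (hw : ‖w‖ < ρ) :
    psSum (P * Q) w = psSum P w * psSum Q w := by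
  unfold psSum
  rw [tsum_mul_tsum_eq_tsum_sum_antidiagonal_of_summable_norm (hP.summable_norm hw)
    (hQ.summable_norm hw)]
  refine tsum_congr fun n => ?_
  rw [PowerSeries.coeff_mul, Finset.sum_mul]
  refine Finset.sum_congr rfl fun kl hkl => ?_
  rw [← Finset.HasAntidiagonal.mem_antidiagonal.1 hkl, pow_add]; ring

theorem hasFPowerSeriesAt (h : PsConv P ρ) (hρ : 0 < ρ) :
    HasFPowerSeriesAt (psSum P)
      (FormalMultilinearSeries.ofScalars ℂ fun n => PowerSeries.coeff n P) 0 := by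
  rw [hasFPowerSeriesAt_iff]
  filter_upwards [Metric.ball_mem_nhds (0 : ℂ) hρ] with z hz
  have := h.hasSum (mem_ball_zero_iff.1 hz)
  simpa [mul_comm] using this

theorem ext (hP : PsConv P ρ) (hQ : PsConv Q ρ) (hρ : 0 < ρ)
    (h : ∀ w : ℂ, ‖w‖ < ρ → psSum P w = psSum Q w) : P = Q := by
  have hev : psSum P =ᶠ[𝓝 0] psSum Q := by
    filter_upwards [Metric.ball_mem_nhds (0 : ℂ) hρ] with z hz
    exact h z (mem_ball_zero_iff.1 hz)
  have := ((hP.hasFPowerSeriesAt hρ).congr hev).eq_formalMultilinearSeries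
    (hQ.hasFPowerSeriesAt hρ)
  ext n
  have hn := congrArg (fun p => FormalMultilinearSeries.coeff p n) this
  simpa using hn

end PsConv

theorem exists_psConv_of_differentiableOn {f : ℂ → ℂ} {ρ : ℝ}
    (hf : DifferentiableOn ℂ f (Metric.ball 0 ρ)) :
    ∃ P : PowerSeries ℂ, PsConv P ρ ∧ ∀ w : ℂ, ‖w‖ < ρ → psSum P w = f w := by
  have key : ∀ w : ℂ, ‖w‖ < ρ →
      HasSum (fun n => PowerSeries.coeff n (PowerSeries.mk fun n =>
        ((n.factorial : ℂ)⁻¹ * iteratedDeriv n f 0)) * w ^ n) (f w) := by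
    intro w hw
    have := Complex.hasSum_taylorSeries_on_ball (c := 0) (r := ρ) (f := f) hf
      (by simpa using hw : w ∈ Metric.ball (0 : ℂ) ρ)
    refine hasSum_congr_terms this fun n => ?_
    rw [PowerSeries.coeff_mk, smul_eq_mul, smul_eq_mul, sub_zero]
    ring
  refine ⟨_, fun x hx hx' => ?_, fun w hw => (key w hw).tsum_eq⟩
  have := (key x (by simpa [abs_of_nonneg hx] using hx')).summable.norm
  refine this.congr fun n => ?_
  simp [abs_of_nonneg hx]

theorem psSum_zero_right (P : PowerSeries ℂ) : psSum P 0 = PowerSeries.coeff 0 P := by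
  unfold psSum
  rw [tsum_eq_single 0 (fun n hn => by simp [hn])]
  simp

end

/-! ### Positivity of the formal logarithmic derivative -/

noncomputable section

theorem coeff_zero_mul_eq (P Q : PowerSeries ℝ) : PowerSeries.coeff 0 (P * Q) =
    PowerSeries.coeff 0 P * PowerSeries.coeff 0 Q := by
  simp only [PowerSeries.coeff_zero_eq_constantCoeff_apply, map_mul]

-- The inverse `H` satisfies `H = 1 + HG`; since `G` has no constant term, this determines each
-- coefficient of `H` from earlier ones by a sum of nonnegative terms.
open PowerSeries in
theorem coeff_inv_one_sub_nonneg {G : PowerSeries ℝ} (hG : ∀ n, 0 ≤ coeff n G)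
    (hG0 : coeff 0 G = 0) (n : ℕ) : 0 ≤ coeff n (1 - G)⁻¹ := by
  have hc : constantCoeff (1 - G) ≠ 0 := by
    rw [← coeff_zero_eq_constantCoeff_apply, map_sub, hG0]
    simp
  have hH : (1 - G)⁻¹ = 1 + (1 - G)⁻¹ * G := by
    have := PowerSeries.inv_mul_cancel (1 - G) hc
    linear_combination this
  induction n using Nat.strong_induction_on with
  | _ n ih =>
    rw [hH, map_add, coeff_mul]
    refine add_nonneg (by rw [coeff_one]; split_ifs <;> simp) (Finset.sum_nonneg fun kl hkl => ?_)
    have hkl' := Finset.HasAntidiagonal.mem_antidiagonal.1 hkl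
    rcases Nat.eq_zero_or_pos kl.2 with h | h
    · rw [h, hG0, mul_zero]
    · exact mul_nonneg (ih _ (by omega)) (hG _)

-- Logarithmic derivatives add over products, so the factor `1 - G` contributes `2θG/(1 - G)`, with
-- `θ = X d/dX`, which has nonnegative coefficients.
open PowerSeries in
theorem exists_logDeriv_mul_one_sub {V S G : PowerSeries ℝ}
    (hS : 2 * psEuler V = -(S * V)) (hG : ∀ n, 0 ≤ coeff n G) (hG0 : coeff 0 G = 0) :
    ∃ S' : PowerSeries ℝ, 2 * psEuler (V * (1 - G)) = -(S' * (V * (1 - G))) ∧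
      ∀ n, coeff n S ≤ coeff n S' := by
  have hc : constantCoeff (1 - G) ≠ 0 := by
    rw [← coeff_zero_eq_constantCoeff_apply, map_sub, hG0]
    simp
  refine ⟨S + 2 * (psEuler G * (1 - G)⁻¹), ?_, fun n => ?_⟩
  · have := PowerSeries.inv_mul_cancel (1 - G) hc
    rw [psEuler_mul, psEuler_sub, psEuler_one]
    linear_combination (1 - G) * hS + 2 * psEuler G * V * this
  · rw [map_add, two_mul, map_add]
    have : 0 ≤ coeff n (psEuler G * (1 - G)⁻¹) := by
      rw [coeff_mul]
      refine Finset.sum_nonneg fun kl _ => mul_nonneg ?_ (coeff_inv_one_sub_nonneg hG hG0 _)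
      rw [coeff_psEuler]
      exact mul_nonneg (Nat.cast_nonneg _) (hG _)
    linarith

/-- The power series `u` with `J_ν(z) = (z/2)^ν u(z²) / Γ(ν+1)`. -/
def besselSeries (ν : ℝ) : PowerSeries ℝ :=
  PowerSeries.mk fun n =>
    (-1) ^ n * Real.Gamma (ν + 1) / (n.factorial * Real.Gamma (n + ν + 1) * 4 ^ n)

theorem Gamma_natCast_add_pos {ν : ℝ} (hν : 0 ≤ ν) (n : ℕ) : 0 < Real.Gamma (n + ν + 1) :=
  Real.Gamma_pos_of_pos (by positivity)

theorem coeff_zero_besselSeries {ν : ℝ} (hν : 0 ≤ ν) :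
    PowerSeries.coeff 0 (besselSeries ν) = 1 := by
  have := (Gamma_natCast_add_pos hν 0).ne'
  simp only [Nat.cast_zero, zero_add] at this
  simp [besselSeries, this]

theorem besselSeries_recurrence {ν : ℝ} (hν : 0 ≤ ν) (n : ℕ) :
    (2 * (n + 1) * (2 * (n + 1) + 2 * ν)) * PowerSeries.coeff (n + 1) (besselSeries ν) =
      -PowerSeries.coeff n (besselSeries ν) := by
  have h1 := (Gamma_natCast_add_pos hν n).ne'
  have h2 : Real.Gamma ((n + 1 : ℕ) + ν + 1) = (n + ν + 1) * Real.Gamma (n + ν + 1) := by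
    rw [← Real.Gamma_add_one (by positivity)]
    congr 1; push_cast; ring
  have h3 : (n + ν + 1 : ℝ) ≠ 0 := by positivity
  have h4 : (n.factorial : ℝ) ≠ 0 := by positivity
  have h5 : (n + 1 : ℝ) ≠ 0 := by positivity
  simp only [besselSeries, PowerSeries.coeff_mk]
  rw [h2, Nat.factorial_succ]
  push_cast
  field_simp
  ring

/-- This is Bessel's equation in the variable `w = z²`, after the factor `z^ν` is removed. -/
theorem psEuler_psEuler_besselSeries {ν : ℝ} (hν : 0 ≤ ν) :
    4 * psEuler (psEuler (besselSeries ν)) + PowerSeries.C (4 * ν) * psEuler (besselSeries ν) =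
      -(PowerSeries.X * besselSeries ν) := by
  ext n
  rw [show (4 : PowerSeries ℝ) = PowerSeries.C 4 from (map_ofNat PowerSeries.C 4).symm]
  simp only [map_add, map_neg, PowerSeries.coeff_C_mul, coeff_psEuler]
  cases n with
  | zero => simp
  | succ n =>
    rw [PowerSeries.coeff_succ_X_mul, ← besselSeries_recurrence hν]
    push_cast; ring

-- Bessel's equation becomes the Riccati equation `2θS + 2νS = S² + X`, that is, `(2n + 2ν)sₙ = ∑
-- sᵢsₙ₋ᵢ` for `n ≥ 2`, with `s₁ = 1/(2 + 2ν)`. Positivity and geometric growth follow by strong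
-- induction.
open PowerSeries in
theorem exists_logDeriv_besselSeries {ν : ℝ} (hν : 0 ≤ ν) :
    ∃ S : PowerSeries ℝ, 2 * psEuler (besselSeries ν) = -(S * besselSeries ν) ∧ coeff 0 S = 0 ∧
      ∃ A q : ℝ, 0 < A ∧ 0 < q ∧ ∀ n, 1 ≤ n → A * q ^ n ≤ coeff n S := by
  set V := besselSeries ν with hV
  have hV0 : constantCoeff V ≠ 0 := by
    rw [← coeff_zero_eq_constantCoeff_apply, coeff_zero_besselSeries hν]; exact one_ne_zero
  have hVne : V ≠ 0 := fun h => hV0 (by simp [h])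
  set S := -(2 * psEuler V) * V⁻¹ with hSdef
  have hS : 2 * psEuler V = -(S * V) := by
    have := PowerSeries.inv_mul_cancel V hV0
    rw [hSdef]
    linear_combination -2 * psEuler V * this
  clear_value S
  have hS0 : coeff 0 S = 0 := by
    have := congrArg (coeff 0) hS
    rw [two_mul, map_add, coeff_psEuler, map_neg, coeff_zero_mul_eq, coeff_zero_besselSeries hν] at this
    simpa using this.symm
  have hric : 2 * psEuler S + C (2 * ν) * S = S * S + X := by
    have hE : 2 * psEuler (psEuler V) = -(psEuler S * V + S * psEuler V) := by
      have := congrArg psEuler hS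
      rw [psEuler_neg, psEuler_mul S V, two_mul, psEuler_add, ← two_mul] at this
      exact this
    have hode := psEuler_psEuler_besselSeries hν
    rw [← hV] at hode
    have hC : (C (4 * ν) : PowerSeries ℝ) = 2 * C (2 * ν) := by
      rw [show (4 * ν) = 2 * (2 * ν) by ring, map_mul, map_ofNat]
    rw [hC] at hode
    refine mul_right_cancel₀ hVne ?_
    linear_combination -hode + 2 * hE - (S - C (2 * ν)) * hS
  have hrec : ∀ n : ℕ, (2 * n + 2 * ν) * coeff n S =
      coeff n (S * S) + coeff n (X : PowerSeries ℝ) := by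
    intro n
    have := congrArg (coeff n) hric
    rw [map_add, map_add, two_mul, map_add, coeff_psEuler, coeff_C_mul] at this
    linear_combination this
  have hs1 : coeff 1 S = 1 / (2 + 2 * ν) := by
    have := hrec 1
    rw [coeff_mul, Finset.Nat.sum_antidiagonal_eq_sum_range_succ_mk] at this
    simp [Finset.sum_range_succ, hS0] at this
    rw [eq_div_iff (by positivity)]
    linarith
  -- `q` makes `A q = s₁`, so the bound is an equality at `n = 1`. `A` is chosen so that `2(m + 2) +
  -- 2ν ≤ (m + 1)A` for all `m ≥ 0`, with equality at `m = 0`; the induction step needs exactly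
  -- this.
  refine ⟨S, hS, hS0, 4 + 2 * ν, 1 / (2 + 2 * ν) / (4 + 2 * ν), by positivity, by positivity, ?_⟩
  set A := 4 + 2 * ν with hA
  have hApos : 0 < A := by positivity
  set q := 1 / (2 + 2 * ν) / A with hq
  have hqpos : 0 < q := by positivity
  intro n
  induction n using Nat.strong_induction_on with
  | _ n ih =>
    intro hn
    obtain rfl | ⟨m, rfl⟩ : n = 1 ∨ ∃ m, n = m + 2 := by
      rcases n with _ | _ | m
      · omega
      · left; rfl
      · right; exact ⟨m, rfl⟩
    · rw [hs1, hq, pow_one, mul_div_cancel₀ _ hApos.ne']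
    -- The two end terms of the convolution vanish because `s₀ = 0`. Each of the remaining `m + 1`
    -- terms is at least `A² q^(m+2)` by induction.
    · have h := hrec (m + 2)
      rw [coeff_mul, Finset.Nat.sum_antidiagonal_eq_sum_range_succ_mk, Finset.sum_range_succ,
        Finset.sum_range_succ', coeff_X, if_neg (by omega)] at h
      simp only [hS0, Nat.sub_self, zero_mul, mul_zero, add_zero] at h
      have hsum : ∑ _i ∈ Finset.range (m + 1), A * A * q ^ (m + 2) ≤
          ∑ i ∈ Finset.range (m + 1), coeff (i + 1) S * coeff (m + 2 - (i + 1)) S := by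
        refine Finset.sum_le_sum fun i hi => ?_
        have hi' := Finset.mem_range.1 hi
        have e : A * A * q ^ (m + 2) = (A * q ^ (i + 1)) * (A * q ^ (m + 2 - (i + 1))) := by
          have : q ^ (m + 2) = q ^ (i + 1) * q ^ (m + 2 - (i + 1)) := by
            rw [← pow_add]; congr 1; omega
          rw [this]; ring
        rw [e]
        have h1 := ih (i + 1) (by omega) (by omega)
        exact mul_le_mul h1 (ih (m + 2 - (i + 1)) (by omega) (by omega)) (by positivity)
          (le_trans (by positivity) h1)
      rw [← h, Finset.sum_const, Finset.card_range, nsmul_eq_mul] at hsum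
      push_cast at hsum
      have hD : (0 : ℝ) < 2 * ((m : ℝ) + 2) + 2 * ν := by positivity
      refine le_of_mul_le_mul_left (le_trans ?_ hsum) hD
      have hAq : 0 < A * q ^ (m + 2) := by positivity
      have : 2 * ((m : ℝ) + 2) + 2 * ν ≤ (m + 1) * A := by
        rw [hA]
        nlinarith [mul_nonneg (Nat.cast_nonneg (α := ℝ) m) hν, Nat.cast_nonneg (α := ℝ) m]
      calc _ ≤ ((m + 1) * A) * (A * q ^ (m + 2)) := mul_le_mul_of_nonneg_right this hAq.le
        _ = _ := by ring

/-- The power series `v` with `N_ν(z) = Q(ν) (z/2)^ν v(z²) / Γ(ν+1)`. -/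
def besselNSeries (a b c ν : ℝ) : PowerSeries ℝ :=
  PowerSeries.mk fun n =>
    besselQ a b c (2 * n + ν) / besselQ a b c ν * PowerSeries.coeff n (besselSeries ν)

theorem coeff_zero_besselNSeries {a b c ν : ℝ} (hν : 0 ≤ ν) (hQ : besselQ a b c ν ≠ 0) :
    PowerSeries.coeff 0 (besselNSeries a b c ν) = 1 := by
  simp only [besselNSeries, PowerSeries.coeff_mk, coeff_zero_besselSeries hν]
  simp [hQ]

/-- The quadratic either has the signs that make `J_ν'/J_ν` enough, or is split over `ℝ`. -/
theorem besselQ_signs_or_split {a b c ν : ℝ} (habc : (c = 0 ∧ a ≠ b) ∨ (0 < c ∧ a < b))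
    (hν : 0 ≤ ν) (hν₀ : ∀ x : ℝ, besselQ a b c x = 0 → x ≤ ν) (hQ : besselQ a b c ν ≠ 0) :
    (0 ≤ (b - a) / besselQ a b c ν ∧ 0 ≤ a / besselQ a b c ν) ∨
      ∃ r₁ r₂ : ℝ, r₁ < ν ∧ r₂ < ν ∧ a ≠ 0 ∧ ∀ x, besselQ a b c x = a * (x - r₁) * (x - r₂) := by
  have hlt : ∀ x, besselQ a b c x = 0 → x < ν := fun x hx =>
    lt_of_le_of_ne (hν₀ x hx) fun h => hQ (h ▸ hx)
  have split : ∀ r₁ r₂ : ℝ, a ≠ 0 → (∀ x, besselQ a b c x = a * (x - r₁) * (x - r₂)) →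
      ∃ r₁ r₂ : ℝ, r₁ < ν ∧ r₂ < ν ∧ a ≠ 0 ∧ ∀ x, besselQ a b c x = a * (x - r₁) * (x - r₂) :=
    fun r₁ r₂ ha h => ⟨r₁, r₂, hlt _ (by rw [h]; ring), hlt _ (by rw [h]; ring), ha, h⟩
  rcases habc with ⟨rfl, hab⟩ | ⟨hc, hab⟩
  · rcases eq_or_ne a 0 with rfl | ha
    · left
      -- Here `Q(ν) = bν ≠ 0`, so the first ratio is `1/ν`, whatever the sign of `b`.
      have e : besselQ 0 b 0 ν = b * ν := by unfold besselQ; ring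
      rw [e] at hQ ⊢
      refine ⟨?_, by simp⟩
      rw [sub_zero, div_mul_eq_div_div, div_self (left_ne_zero_of_mul hQ)]
      positivity
    · right
      refine split 0 (1 - b / a) ha fun x => ?_
      unfold besselQ; field_simp; ring
  · rcases le_or_gt 0 a with ha | ha
    · left
      have hpos : 0 < besselQ a b c ν := by
        have : besselQ a b c ν = a * ν ^ 2 + (b - a) * ν + c := by unfold besselQ; ring
        rw [this]
        have := mul_nonneg (sub_nonneg.2 hab.le) hν
        positivity
      exact ⟨div_nonneg (sub_nonneg.2 hab.le) hpos.le, div_nonneg ha hpos.le⟩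
    · right
      -- With `a < 0 < c` the discriminant is positive, so both roots of `Q` are real.
      have hd : 0 ≤ (b - a) ^ 2 - 4 * a * c := by
        nlinarith [sq_nonneg (b - a), mul_pos_of_neg_of_neg ha (neg_lt_zero.2 hc)]
      set d := Real.sqrt ((b - a) ^ 2 - 4 * a * c) with hddef
      have hd2 : d ^ 2 = (b - a) ^ 2 - 4 * a * c := Real.sq_sqrt hd
      refine split ((-(b - a) + d) / (2 * a)) ((-(b - a) - d) / (2 * a)) ha.ne fun x => ?_
      unfold besselQ
      have := ha.ne
      field_simp
      linear_combination hd2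

-- The series of `N_ν` is `Q(ν + 2θ)u / Q(ν)`, where `u` is the series of `J_ν`. In the case of good
-- signs, expand `Q(ν + 2θ) = Q(ν) + (b - a)·2θ + a(4θ² + 4νθ)`; Bessel's equation replaces the last
-- bracket by `-X`, which leaves a single factor `1 - kS - mX`. In the split case the operator is
-- the product of `1 + 2θ/(ν - r₁)` and `1 + 2θ/(ν - r₂)`, and each first-order operator acts as
-- multiplication by `1 - S/(ν - rᵢ)` with the current `S`.
open PowerSeries in
theorem exists_logDeriv_besselNSeries {a b c ν : ℝ}
    (habc : (c = 0 ∧ a ≠ b) ∨ (0 < c ∧ a < b)) (hν : 0 ≤ ν)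
    (hν₀ : ∀ x : ℝ, besselQ a b c x = 0 → x ≤ ν) (hQ : besselQ a b c ν ≠ 0) :
    ∃ S : PowerSeries ℝ, 2 * psEuler (besselNSeries a b c ν) = -(S * besselNSeries a b c ν) ∧
      ∃ A q : ℝ, 0 < A ∧ 0 < q ∧ ∀ n, 1 ≤ n → A * q ^ n ≤ coeff n S := by
  obtain ⟨S, hS, hS0, A, q, hA, hq, hAq⟩ := exists_logDeriv_besselSeries hν
  have hSnn : ∀ n, 0 ≤ coeff n S := by
    intro n
    rcases Nat.eq_zero_or_pos n with rfl | h
    · rw [hS0]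
    · exact le_trans (by positivity) (hAq n h)
  set V := besselSeries ν with hV
  have h2 : ∀ (P : PowerSeries ℝ) n, coeff n (2 * P) = 2 * coeff n P := fun P n => by
    rw [two_mul, map_add, two_mul]
  rcases besselQ_signs_or_split habc hν hν₀ hQ with ⟨h1, h3⟩ | ⟨r₁, r₂, hr₁, hr₂, ha, hr⟩
  · set k := (b - a) / besselQ a b c ν with hk
    set m := a / besselQ a b c ν with hm
    have hX : ∀ n, 0 ≤ coeff n (X : PowerSeries ℝ) := fun n => by
      rw [coeff_X]; split_ifs <;> simp
    obtain ⟨S', hS', hle⟩ := exists_logDeriv_mul_one_sub (G := C k * S + C m * X) hS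
      (fun n => by
        rw [map_add, coeff_C_mul, coeff_C_mul]
        exact add_nonneg (mul_nonneg h1 (hSnn n)) (mul_nonneg h3 (hX n)))
      (by rw [map_add, coeff_C_mul, coeff_C_mul, hS0]; simp)
    have hVN : V * (1 - (C k * S + C m * X)) = besselNSeries a b c ν := by
      have hode := psEuler_psEuler_besselSeries hν
      rw [← hV] at hode
      have : V * (1 - (C k * S + C m * X)) = V + C k * (2 * psEuler V) +
          C m * (4 * psEuler (psEuler V) + C (4 * ν) * psEuler V) := by
        rw [hode]
        linear_combination -C k * hS
      rw [this]
      ext n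
      rw [show (4 : PowerSeries ℝ) = PowerSeries.C 4 from (map_ofNat PowerSeries.C 4).symm]
      simp only [map_add, coeff_C_mul, coeff_psEuler, h2, besselNSeries, coeff_mk, ← hV]
      rw [hk, hm]
      field_simp
      unfold besselQ
      ring
    rw [hVN] at hS'
    exact ⟨S', hS', A, q, hA, hq, fun n hn => (hAq n hn).trans (hle n)⟩
  · have hk₁ : 0 ≤ 1 / (ν - r₁) := by have := sub_pos.2 hr₁; positivity
    have hk₂ : 0 ≤ 1 / (ν - r₂) := by have := sub_pos.2 hr₂; positivity
    obtain ⟨S₁, hS₁, hle₁⟩ := exists_logDeriv_mul_one_sub (G := C (1 / (ν - r₁)) * S) hS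
      (fun n => by rw [coeff_C_mul]; exact mul_nonneg hk₁ (hSnn n))
      (by rw [coeff_C_mul, hS0, mul_zero])
    have hV₁ : V * (1 - C (1 / (ν - r₁)) * S) = V + C (1 / (ν - r₁)) * (2 * psEuler V) := by
      linear_combination -C (1 / (ν - r₁)) * hS
    have hV₁0 : coeff 0 (V * (1 - C (1 / (ν - r₁)) * S)) = 1 := by
      rw [hV₁, map_add, coeff_C_mul, h2, coeff_psEuler, coeff_zero_besselSeries hν]; simp
    have hS₁0 : coeff 0 S₁ = 0 := by
      have := congrArg (coeff 0) hS₁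
      rw [h2, coeff_psEuler, map_neg, coeff_zero_mul_eq S₁, hV₁0] at this
      simpa using this.symm
    obtain ⟨S₂, hS₂, hle₂⟩ := exists_logDeriv_mul_one_sub (G := C (1 / (ν - r₂)) * S₁) hS₁
      (fun n => by rw [coeff_C_mul]; exact mul_nonneg hk₂ ((hSnn n).trans (hle₁ n)))
      (by rw [coeff_C_mul, hS₁0, mul_zero])
    have hVN : V * (1 - C (1 / (ν - r₁)) * S) * (1 - C (1 / (ν - r₂)) * S₁) =
        besselNSeries a b c ν := by
      have : V * (1 - C (1 / (ν - r₁)) * S) * (1 - C (1 / (ν - r₂)) * S₁) =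
          V * (1 - C (1 / (ν - r₁)) * S) +
            C (1 / (ν - r₂)) * (2 * psEuler (V * (1 - C (1 / (ν - r₁)) * S))) := by
        linear_combination -C (1 / (ν - r₂)) * hS₁
      rw [this, hV₁]
      ext n
      simp only [map_add, coeff_C_mul, coeff_psEuler, h2, besselNSeries, coeff_mk, ← hV, hr]
      have := (sub_pos.2 hr₁).ne'
      have := (sub_pos.2 hr₂).ne'
      field_simp
      ring
    rw [hVN] at hS₂
    exact ⟨S₂, hS₂, A, q, hA, hq, fun n hn => (hAq n hn).trans ((hle₁ n).trans (hle₂ n))⟩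

end

/-! ### Analytic consequences: the first zero and the growth of `S` -/

noncomputable section

theorem coeff_two_mul (P : PowerSeries ℝ) (n : ℕ) :
    PowerSeries.coeff n (2 * P) = 2 * PowerSeries.coeff n P := by
  rw [two_mul, map_add, two_mul]

/-- A real power series regarded as a complex one. -/
def psOfReal (P : PowerSeries ℝ) : PowerSeries ℂ := PowerSeries.map Complex.ofRealHom P

theorem coeff_psOfReal (P : PowerSeries ℝ) (n : ℕ) :
    PowerSeries.coeff n (psOfReal P) = ((PowerSeries.coeff n P : ℝ) : ℂ) := by
  simp [psOfReal]

theorem psOfReal_mul (P Q : PowerSeries ℝ) : psOfReal (P * Q) = psOfReal P * psOfReal Q :=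
  map_mul _ _ _

theorem psEuler_psOfReal (P : PowerSeries ℝ) : psEuler (psOfReal P) = psOfReal (psEuler P) := by
  ext n
  simp [coeff_psEuler, coeff_psOfReal]

theorem psSum_psOfReal_ofReal (P : PowerSeries ℝ) (x : ℝ) :
    psSum (psOfReal P) x = ((∑' n, PowerSeries.coeff n P * x ^ n : ℝ) : ℂ) := by
  rw [psSum, Complex.ofReal_tsum]
  simp [coeff_psOfReal]

theorem norm_psSum_psOfReal_le {P : PowerSeries ℝ} {ρ : ℝ} (h : PsConv (psOfReal P) ρ)
    (hP : ∀ n, 0 ≤ PowerSeries.coeff n P) {w : ℂ} (hw : ‖w‖ < ρ) :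
    ‖psSum (psOfReal P) w‖ ≤ ∑' n, PowerSeries.coeff n P * ‖w‖ ^ n := by
  refine (norm_tsum_le_tsum_norm (h.summable_norm hw)).trans_eq (tsum_congr fun n => ?_)
  rw [norm_mul, norm_pow, coeff_psOfReal, Complex.norm_real, Real.norm_of_nonneg (hP n)]

theorem PsConv.summable_real {P : PowerSeries ℝ} {ρ : ℝ} (h : PsConv (psOfReal P) ρ)
    {x : ℝ} (hx : 0 ≤ x) (hxρ : x < ρ) : Summable fun n => PowerSeries.coeff n P * x ^ n := by
  refine Summable.of_norm ((h x hx hxρ).congr fun n => ?_)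
  rw [norm_mul, norm_pow, coeff_psOfReal, Complex.norm_real, Real.norm_of_nonneg hx]

/-- The Euler operator multiplies the `n`-th Taylor coefficient by `n`, so it kills only constants.
-/
theorem eq_of_mul_deriv_eq_zero {g : ℂ → ℂ} {ρ : ℝ}
    (hg : DifferentiableOn ℂ g (Metric.ball 0 ρ))
    (h : ∀ w : ℂ, ‖w‖ < ρ → w * deriv g w = 0) {w : ℂ} (hw : ‖w‖ < ρ) : g w = g 0 := by
  have hρ : 0 < ρ := (norm_nonneg w).trans_lt hw
  obtain ⟨P, hP, hPg⟩ := exists_psConv_of_differentiableOn hg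
  have hder : ∀ z : ℂ, ‖z‖ < ρ → deriv (psSum P) z = deriv g z := by
    intro z hz
    refine Filter.EventuallyEq.deriv_eq ?_
    filter_upwards [Metric.isOpen_ball.mem_nhds (mem_ball_zero_iff.2 hz)] with y hy
    exact hPg y (mem_ball_zero_iff.1 hy)
  have h0 : psEuler P = 0 := by
    refine hP.euler.ext (Q := 0) (fun x _ _ => by simp) hρ fun z hz => ?_
    rw [hP.psSum_euler hz, hder z hz, h z hz]
    simp [psSum]
  have hc : ∀ n, n ≠ 0 → PowerSeries.coeff n P = 0 := by
    intro n hn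
    have := congrArg (PowerSeries.coeff n) h0
    rw [coeff_psEuler, map_zero] at this
    exact (mul_eq_zero.1 this).resolve_left (Nat.cast_ne_zero.2 hn)
  rw [← hPg w hw, ← hPg 0 (by simpa using hρ), psSum_zero_right, psSum,
    tsum_eq_single 0 fun n hn => by rw [hc n hn, zero_mul]]
  simp

theorem logDeriv_relation {V S : PowerSeries ℝ} (hS : 2 * psEuler V = -(S * V)) {ρ : ℝ}
    (hV : PsConv (psOfReal V) ρ) (hSc : PsConv (psOfReal S) ρ) {w : ℂ} (hw : ‖w‖ < ρ) :
    psSum (psOfReal S) w * psSum (psOfReal V) w = -(2 * (w * deriv (psSum (psOfReal V)) w)) := by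
  rw [← hSc.psSum_mul hV hw, ← psOfReal_mul, ← hV.psSum_euler hw, psEuler_psOfReal]
  have : S * V = -(2 * psEuler V) := by rw [hS, neg_neg]
  rw [this, psSum, psSum, ← tsum_mul_left, ← tsum_neg]
  refine tsum_congr fun n => ?_
  rw [coeff_psOfReal, coeff_psOfReal, map_neg, coeff_two_mul]
  push_cast
  ring

/-- The quotient `-2wV'/V` is analytic on a zero-free disk, so its Taylor series `P` converges
there. Formally `PV = SV`, and cancelling `V` gives `P = S`. -/
theorem psConv_logDeriv_of_ne_zero {V S : PowerSeries ℝ} (hS : 2 * psEuler V = -(S * V))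
    (hV0 : PowerSeries.coeff 0 V = 1) {ρ : ℝ} (hV : PsConv (psOfReal V) ρ)
    (hne : ∀ w : ℂ, ‖w‖ < ρ → psSum (psOfReal V) w ≠ 0) : PsConv (psOfReal S) ρ := by
  rcases le_or_gt ρ 0 with hρ | hρ
  · intro x hx hx'; linarith
  obtain ⟨P, hP, hPE⟩ := exists_psConv_of_differentiableOn (ρ := ρ)
    (f := fun w => -(2 * psSum (psEuler (psOfReal V)) w) / psSum (psOfReal V) w)
    (((hV.euler.differentiableOn.const_mul 2).neg).div hV.differentiableOn
      fun w hw => hne w (mem_ball_zero_iff.1 hw))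
  have hVne : psOfReal V ≠ 0 := by
    intro h
    have := congrArg (PowerSeries.coeff 0) h
    rw [coeff_psOfReal, hV0] at this
    simp at this
  have h2 : PsConv (psOfReal (-(2 * psEuler V))) ρ := by
    intro x hx hx'
    refine ((hV.euler x hx hx').mul_left 2).congr fun n => ?_
    rw [psEuler_psOfReal, coeff_psOfReal, coeff_psOfReal, map_neg, coeff_two_mul,
      Complex.ofReal_neg, norm_neg, Complex.ofReal_mul, norm_mul]
    simp [mul_assoc]
  have hPV : P * psOfReal V = psOfReal S * psOfReal V := by
    have e : psOfReal S * psOfReal V = psOfReal (-(2 * psEuler V)) := by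
      rw [← psOfReal_mul, hS, neg_neg]
    rw [e]
    refine (hP.mul hV).ext h2 hρ fun w hw => ?_
    rw [hP.psSum_mul hV hw, hPE w hw, div_mul_cancel₀ _ (hne w hw), psEuler_psOfReal, psSum, psSum,
      ← tsum_mul_left, ← tsum_neg]
    refine tsum_congr fun n => ?_
    rw [coeff_psOfReal, coeff_psOfReal, map_neg, coeff_two_mul]
    push_cast
    ring
  rwa [← mul_right_cancel₀ hVne hPV]

/-- The antiderivative `∑ sₙ/(2n) wⁿ` of `S(w)/(2w)`. -/
def psLogIntegral (S : PowerSeries ℝ) : PowerSeries ℝ :=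
  PowerSeries.mk fun n => PowerSeries.coeff n S / (2 * n)

theorem coeff_psLogIntegral_le {S : PowerSeries ℝ} (hS : ∀ n, 0 ≤ PowerSeries.coeff n S) (n : ℕ) :
    PowerSeries.coeff n (psLogIntegral S) ≤ PowerSeries.coeff n S := by
  rw [psLogIntegral, PowerSeries.coeff_mk]
  -- At `n = 0` the coefficient of the integral is a division by zero, hence `0`.
  rcases Nat.eq_zero_or_pos n with rfl | h
  · simpa using hS 0
  · refine div_le_self (hS n) ?_
    have : (1 : ℝ) ≤ n := by exact_mod_cast h
    linarith

theorem coeff_psLogIntegral_nonneg {S : PowerSeries ℝ} (hS : ∀ n, 0 ≤ PowerSeries.coeff n S)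
    (n : ℕ) : 0 ≤ PowerSeries.coeff n (psLogIntegral S) := by
  rw [psLogIntegral, PowerSeries.coeff_mk]
  have := hS n
  positivity

theorem PsConv.psLogIntegral {S : PowerSeries ℝ} (hS : ∀ n, 0 ≤ PowerSeries.coeff n S) {ρ : ℝ}
    (h : PsConv (psOfReal S) ρ) : PsConv (psOfReal (psLogIntegral S)) ρ := by
  refine h.of_le fun n => ?_
  rw [coeff_psOfReal, coeff_psOfReal, Complex.norm_real, Complex.norm_real,
    Real.norm_of_nonneg (coeff_psLogIntegral_nonneg hS n), Real.norm_of_nonneg (hS n)]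
  exact coeff_psLogIntegral_le hS n

theorem mul_deriv_psLogIntegral {S : PowerSeries ℝ} (hS : ∀ n, 0 ≤ PowerSeries.coeff n S)
    (hS0 : PowerSeries.coeff 0 S = 0) {ρ : ℝ} (h : PsConv (psOfReal S) ρ) {w : ℂ} (hw : ‖w‖ < ρ) :
    2 * (w * deriv (psSum (psOfReal (psLogIntegral S))) w) = psSum (psOfReal S) w := by
  rw [← (PsConv.psLogIntegral hS h).psSum_euler hw, psSum, psSum, ← tsum_mul_left]
  refine tsum_congr fun n => ?_
  rw [psEuler_psOfReal, coeff_psOfReal, coeff_psOfReal, coeff_psEuler, psLogIntegral,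
    PowerSeries.coeff_mk]
  rcases Nat.eq_zero_or_pos n with rfl | hn
  · simp [hS0]
  · have : (n : ℂ) ≠ 0 := Nat.cast_ne_zero.2 hn.ne'
    push_cast
    field_simp

/-- With `T` the integral of `S/(2w)`, the Euler derivative of `V e^T` vanishes, so this product
keeps its value `1` at the origin. -/
theorem psSum_eq_exp_psLogIntegral {V S : PowerSeries ℝ} (hS : 2 * psEuler V = -(S * V))
    (hV0 : PowerSeries.coeff 0 V = 1) (hSnn : ∀ n, 0 ≤ PowerSeries.coeff n S)
    (hS0 : PowerSeries.coeff 0 S = 0) {ρ : ℝ}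
    (hV : PsConv (psOfReal V) ρ) (hSc : PsConv (psOfReal S) ρ) {w : ℂ} (hw : ‖w‖ < ρ) :
    psSum (psOfReal V) w = Complex.exp (-psSum (psOfReal (psLogIntegral S)) w) := by
  have hT := PsConv.psLogIntegral hSnn hSc
  have hconst := eq_of_mul_deriv_eq_zero (ρ := ρ)
    (g := fun w => psSum (psOfReal V) w * Complex.exp (psSum (psOfReal (psLogIntegral S)) w))
    (hV.differentiableOn.mul hT.differentiableOn.cexp) (fun z hz => by
      have hd := (hV.differentiableAt hz).hasDerivAt.mul (hT.differentiableAt hz).hasDerivAt.cexp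
      have := hd.deriv
      simp only [Pi.mul_def] at this
      rw [this]
      have h1 := logDeriv_relation hS hV hSc hz
      have h2 := mul_deriv_psLogIntegral hSnn hS0 hSc hz
      linear_combination (Complex.exp (psSum (psOfReal (psLogIntegral S)) z) / 2) *
        (h1 + psSum (psOfReal V) z * h2)) hw
  simp only [psSum_zero_right, coeff_psOfReal, hV0] at hconst
  have h0 : PowerSeries.coeff 0 (psLogIntegral S) = 0 := by
    rw [psLogIntegral, PowerSeries.coeff_mk, hS0, zero_div]
  rw [h0] at hconst
  rw [Complex.exp_neg]
  exact eq_inv_of_mul_eq_one_left (by simpa using hconst)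

/-- If `-2wV'/V` has nonnegative Taylor coefficients that grow at least geometrically, then a zero
of the entire function `V` of smallest modulus is real and positive. -/
theorem exists_first_zero {V S : PowerSeries ℝ} (hS : 2 * psEuler V = -(S * V))
    (hV0 : PowerSeries.coeff 0 V = 1) (hV : ∀ ρ, PsConv (psOfReal V) ρ)
    (hSnn : ∀ n, 0 ≤ PowerSeries.coeff n S) (hS0 : PowerSeries.coeff 0 S = 0)
    {A q : ℝ} (hA : 0 < A) (hq : 0 < q)
    (hAq : ∀ n, 1 ≤ n → A * q ^ n ≤ PowerSeries.coeff n S) :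
    ∃ x₀ : ℝ, 0 < x₀ ∧ psSum (psOfReal V) x₀ = 0 ∧
      ∀ w : ℂ, ‖w‖ < x₀ → psSum (psOfReal V) w ≠ 0 := by
  have hdiff : ∀ w, DifferentiableAt ℂ (psSum (psOfReal V)) w := fun w =>
    (hV (‖w‖ + 1)).differentiableAt (by linarith)
  have hcont : Continuous (psSum (psOfReal V)) :=
    continuous_iff_continuousAt.2 fun w => (hdiff w).continuousAt
  have hne : (psSum (psOfReal V) ⁻¹' {0}).Nonempty := by
    by_contra hemp
    rw [Set.not_nonempty_iff_eq_empty] at hemp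
    -- If `V` had no zero, `S` would converge at `1/q`, where its terms of index at least `1` are
    -- bounded below by `A`.
    have hconv : PsConv (psOfReal S) (1 / q + 1) :=
      psConv_logDeriv_of_ne_zero hS hV0 (hV _) fun w _ hw => by
        have : w ∈ psSum (psOfReal V) ⁻¹' {0} := hw
        rw [hemp] at this
        exact this
    have hsum := hconv.summable_real (x := 1 / q) (by positivity) (by linarith)
    have hlim := hsum.tendsto_atTop_zero
    have : A ≤ 0 := by
      refine ge_of_tendsto hlim ?_
      filter_upwards [eventually_ge_atTop 1] with n hn
      calc A = A * q ^ n * (1 / q) ^ n := by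
            rw [mul_assoc, ← mul_pow, mul_one_div_cancel hq.ne', one_pow, mul_one]
        _ ≤ _ := mul_le_mul_of_nonneg_right (hAq n hn) (by positivity)
    linarith
  obtain ⟨w₀, hw₀, hmin⟩ := (isClosed_singleton.preimage hcont).exists_infDist_eq_dist hne 0
  rw [dist_zero_left] at hmin
  have hw₀' : psSum (psOfReal V) w₀ = 0 := hw₀
  have hw₀ne : w₀ ≠ 0 := by
    rintro rfl
    rw [psSum_zero_right, coeff_psOfReal, hV0] at hw₀'
    simp at hw₀'
  have hnz : ∀ w : ℂ, ‖w‖ < ‖w₀‖ → psSum (psOfReal V) w ≠ 0 := by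
    intro w hw h
    have := Metric.infDist_le_dist_of_mem (x := 0) (show w ∈ psSum (psOfReal V) ⁻¹' {0} from h)
    rw [hmin, dist_zero_left] at this
    linarith
  refine ⟨‖w₀‖, norm_pos_iff.2 hw₀ne, ?_, hnz⟩
  have hSc := psConv_logDeriv_of_ne_zero hS hV0 (hV ‖w₀‖) hnz
  have hT := PsConv.psLogIntegral hSnn hSc
  -- `V = e^(-T)` and `Re T(w) ≤ T(|w|)`, since `T` has nonnegative coefficients. Letting `w` tend
  -- radially to the nearest zero `w₀` then forces `V(|w₀|) = 0`.
  have hle : ∀ w : ℂ, ‖w‖ < ‖w₀‖ →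
      ‖psSum (psOfReal V) (‖w‖ : ℂ)‖ ≤ ‖psSum (psOfReal V) w‖ := by
    intro w hw
    rw [psSum_eq_exp_psLogIntegral hS hV0 hSnn hS0 (hV _) hSc hw,
      psSum_eq_exp_psLogIntegral hS hV0 hSnn hS0 (hV _) hSc (w := (‖w‖ : ℂ)) (by simpa using hw),
      Complex.norm_exp, Complex.norm_exp, psSum_psOfReal_ofReal]
    refine Real.exp_le_exp.2 ?_
    rw [Complex.neg_re, Complex.neg_re, neg_le_neg_iff, Complex.ofReal_re]
    exact (Complex.re_le_norm _).trans
      (norm_psSum_psOfReal_le hT (coeff_psLogIntegral_nonneg hSnn) hw)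
  have hlim1 : Tendsto (fun t : ℝ => ‖psSum (psOfReal V) ((t * ‖w₀‖ : ℝ) : ℂ)‖) (𝓝[<] 1)
      (𝓝 ‖psSum (psOfReal V) ((1 * ‖w₀‖ : ℝ) : ℂ)‖) :=
    (Continuous.tendsto (f := fun t : ℝ => ‖psSum (psOfReal V) ((t * ‖w₀‖ : ℝ) : ℂ)‖)
      (by fun_prop) 1).mono_left nhdsWithin_le_nhds
  have hlim2 : Tendsto (fun t : ℝ => ‖psSum (psOfReal V) ((t : ℂ) * w₀)‖) (𝓝[<] 1)
      (𝓝 ‖psSum (psOfReal V) (((1 : ℝ) : ℂ) * w₀)‖) :=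
    (Continuous.tendsto (f := fun t : ℝ => ‖psSum (psOfReal V) ((t : ℂ) * w₀)‖)
      (by fun_prop) 1).mono_left nhdsWithin_le_nhds
  rw [Complex.ofReal_one, one_mul, hw₀', norm_zero] at hlim2
  rw [one_mul] at hlim1
  refine norm_le_zero_iff.1 (le_of_tendsto_of_tendsto hlim1 hlim2 ?_)
  filter_upwards [Ioo_mem_nhdsLT (show (0 : ℝ) < 1 by norm_num)] with t ht
  have hn : ‖(t : ℂ) * w₀‖ = t * ‖w₀‖ := by
    rw [norm_mul, Complex.norm_real, Real.norm_of_nonneg ht.1.le]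
  have := hle (t * w₀) (by
    rw [hn]; exact mul_lt_of_lt_one_left (norm_pos_iff.2 hw₀ne) ht.2)
  rwa [hn] at this

/-- Below the first zero of `V`, the function `-2wV'/V` takes every positive value `t` at a point
`x > 0`, and is smaller than `t` in modulus in the disk of radius `x`. -/
theorem exists_logDeriv_eq {V S : PowerSeries ℝ} (hS : 2 * psEuler V = -(S * V))
    (hV0 : PowerSeries.coeff 0 V = 1) (hV : ∀ ρ, PsConv (psOfReal V) ρ)
    (hSnn : ∀ n, 0 ≤ PowerSeries.coeff n S) (hS0 : PowerSeries.coeff 0 S = 0)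
    (hS1 : 0 < PowerSeries.coeff 1 S) {x₀ : ℝ} (hx₀ : 0 < x₀)
    (hzero : psSum (psOfReal V) x₀ = 0)
    (hnz : ∀ w : ℂ, ‖w‖ < x₀ → psSum (psOfReal V) w ≠ 0) {t : ℝ} (ht : 0 < t) :
    ∃ x : ℝ, 0 < x ∧ x < x₀ ∧ psSum (psOfReal S) x = t ∧
      ∀ w : ℂ, ‖w‖ < x → ‖psSum (psOfReal S) w‖ < t := by
  have hSc := psConv_logDeriv_of_ne_zero hS hV0 (hV x₀) hnz
  have hT := PsConv.psLogIntegral hSnn hSc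
  set σ : ℝ → ℝ := fun x => ∑' n, PowerSeries.coeff n S * x ^ n with hσ
  have hσS : ∀ x : ℝ, psSum (psOfReal S) x = (σ x : ℂ) := fun x => psSum_psOfReal_ofReal S x
  have hσ0 : σ 0 = 0 := by
    have := hσS 0
    rw [Complex.ofReal_zero, psSum_zero_right, coeff_psOfReal, hS0] at this
    exact_mod_cast this.symm
  have hmono : ∀ x y : ℝ, 0 ≤ x → x < y → y < x₀ → σ x < σ y := by
    intro x y hx hxy hy
    refine Summable.tsum_lt_tsum (i := 1) (fun n => ?_) ?_
      (hSc.summable_real hx (hxy.trans hy)) (hSc.summable_real (hx.trans hxy.le) hy)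
    · exact mul_le_mul_of_nonneg_left (pow_le_pow_left₀ hx hxy.le n) (hSnn n)
    · simpa using mul_lt_mul_of_pos_left hxy hS1
  have hcontσ : ContinuousOn σ (Set.Ico 0 x₀) := by
    have : ContinuousOn (fun x : ℝ => (psSum (psOfReal S) x).re) (Set.Ico 0 x₀) := by
      refine Complex.continuous_re.comp_continuousOn
        (hSc.differentiableOn.continuousOn.comp Complex.continuous_ofReal.continuousOn ?_)
      intro x hx
      simpa [abs_of_nonneg hx.1] using hx.2
    refine this.congr fun x _ => ?_
    simp only [hσS x, Complex.ofReal_re]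
  -- If `S < t` on all of `(0, x₀)`, then `T ≤ S < t` coefficientwise, so `V = e^(-T) ≥ e^(-t)`
  -- there, contradicting `V(x₀) = 0`.
  have hbig : ∃ y, 0 < y ∧ y < x₀ ∧ t ≤ σ y := by
    by_contra! hcon
    have hVcont : Continuous fun x : ℝ => ‖psSum (psOfReal V) (x : ℂ)‖ := by
      have : Continuous (psSum (psOfReal V)) := continuous_iff_continuousAt.2 fun w =>
        ((hV (‖w‖ + 1)).differentiableAt (by linarith)).continuousAt
      fun_prop
    have hlim := (hVcont.tendsto x₀).mono_left (nhdsWithin_le_nhds (s := Set.Iio x₀))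
    rw [hzero, norm_zero] at hlim
    have : Real.exp (-t) ≤ 0 := by
      refine ge_of_tendsto hlim ?_
      filter_upwards [Ioo_mem_nhdsLT hx₀] with x hx
      rw [psSum_eq_exp_psLogIntegral hS hV0 hSnn hS0 (hV _) hSc
        (by simpa [abs_of_pos hx.1] using hx.2), Complex.norm_exp, psSum_psOfReal_ofReal,
        Complex.neg_re, Complex.ofReal_re]
      refine Real.exp_le_exp.2 (neg_le_neg ((Summable.tsum_le_tsum (fun n => ?_)
        (hT.summable_real hx.1.le hx.2) (hSc.summable_real hx.1.le hx.2)).trans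
          (hcon x hx.1 hx.2).le))
      exact mul_le_mul_of_nonneg_right (coeff_psLogIntegral_le hSnn n) (pow_nonneg hx.1.le n)
    exact absurd (Real.exp_pos (-t)) (not_lt.2 this)
  obtain ⟨y, hy0, hy, hty⟩ := hbig
  obtain ⟨x, hx, hxt⟩ := intermediate_value_Icc hy0.le
    (hcontσ.mono fun z hz => ⟨hz.1, hz.2.trans_lt hy⟩) ⟨by rw [hσ0]; exact ht.le, hty⟩
  have hxx₀ : x < x₀ := hx.2.trans_lt hy
  refine ⟨x, lt_of_le_of_ne hx.1 ?_, hxx₀, by rw [hσS, hxt], fun w hw => ?_⟩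
  · rintro rfl
    rw [hσ0] at hxt
    exact ht.ne hxt
  · refine (norm_psSum_psOfReal_le hSc hSnn (hw.trans hxx₀)).trans_lt ?_
    rw [← hxt]
    exact hmono _ _ (norm_nonneg w) hw hxx₀

end

/-! ### From the Bessel function to its power series -/

noncomputable section

/-- The Euler operator `ν + 2 X d/dX`, which is `z d/dz` acting on `z^ν P(z²)`. -/
def eulerShift (ν : ℂ) (P : PowerSeries ℂ) : PowerSeries ℂ :=
  PowerSeries.mk fun n => (ν + 2 * n) * PowerSeries.coeff n P

theorem coeff_eulerShift (ν : ℂ) (P : PowerSeries ℂ) (n : ℕ) :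
    PowerSeries.coeff n (eulerShift ν P) = (ν + 2 * n) * PowerSeries.coeff n P := by
  rw [eulerShift, PowerSeries.coeff_mk]

theorem PsConv.eulerShift {P : PowerSeries ℂ} {ρ : ℝ} (h : PsConv P ρ) (ν : ℂ) :
    PsConv (eulerShift ν P) ρ := by
  intro x hx hx'
  refine Summable.of_nonneg_of_le (fun n => by positivity) (fun n => ?_)
    (((h x hx hx').mul_left ‖ν‖).add ((h.euler x hx hx').mul_left 2))
  rw [coeff_eulerShift, coeff_psEuler, norm_mul, norm_mul, ← mul_assoc, ← mul_assoc, ← add_mul,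
    ← mul_assoc, ← add_mul]
  refine mul_le_mul_of_nonneg_right (mul_le_mul_of_nonneg_right ?_ (norm_nonneg _))
    (pow_nonneg hx n)
  refine (norm_add_le _ _).trans_eq ?_
  simp

theorem PsConv.psSum_eulerShift {P : PowerSeries ℂ} {ρ : ℝ} (h : PsConv P ρ) (ν : ℂ) {w : ℂ}
    (hw : ‖w‖ < ρ) :
    psSum (_root_.eulerShift ν P) w = ν * psSum P w + 2 * (w * deriv (psSum P) w) := by
  refine HasSum.tsum_eq (hasSum_congr_terms (((h.hasSum hw).mul_left ν).add
    ((h.hasSum_euler hw).mul_left 2)) fun n => ?_)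
  rw [coeff_eulerShift, coeff_psEuler]
  ring

theorem hasDerivAt_cpow_mul_psSum {P : PowerSeries ℂ} (h : ∀ ρ, PsConv P ρ) (ν : ℂ) {z : ℂ}
    (hz : z ∈ Complex.slitPlane) :
    HasDerivAt (fun z => (z / 2) ^ ν * psSum P (z ^ 2))
      ((z / 2) ^ ν * psSum (eulerShift ν P) (z ^ 2) / z) z := by
  have hz0 : z ≠ 0 := Complex.slitPlane_ne_zero hz
  have hz2 : z / 2 ∈ Complex.slitPlane := by
    rw [Complex.mem_slitPlane_iff] at hz ⊢
    rcases hz with hz | hz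
    · left; simpa using hz
    · right; simpa using hz
  have hw : ‖z ^ 2‖ < ‖z ^ 2‖ + 1 := by linarith
  have h1 : HasDerivAt (fun z : ℂ => (z / 2) ^ ν) (ν * (z / 2) ^ (ν - 1) * (1 / 2)) z :=
    ((hasDerivAt_id z).div_const 2).cpow_const hz2
  have h2 : HasDerivAt (fun z : ℂ => psSum P (z ^ 2)) (deriv (psSum P) (z ^ 2) * (2 * z)) z := by
    have := ((h _).differentiableAt hw).hasDerivAt.comp z (hasDerivAt_pow 2 z)
    simpa [Function.comp_def] using this
  refine (h1.mul h2).congr_deriv ?_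
  rw [(h _).psSum_eulerShift ν hw, Complex.cpow_sub _ _ (Complex.slitPlane_ne_zero hz2),
    Complex.cpow_one]
  field_simp

theorem abs_coeff_besselSeries_le {ν : ℝ} (hν : 0 ≤ ν) (n : ℕ) :
    |PowerSeries.coeff n (besselSeries ν)| ≤ 1 / n.factorial := by
  induction n with
  | zero => rw [coeff_zero_besselSeries hν]; simp
  | succ n ih =>
    have h := congrArg abs (besselSeries_recurrence hν n)
    have hpos : (0 : ℝ) < 2 * (n + 1) * (2 * (n + 1) + 2 * ν) := by positivity
    rw [abs_mul, abs_neg, abs_of_pos hpos] at h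
    have hge : (n + 1 : ℝ) ≤ 2 * (n + 1) * (2 * (n + 1) + 2 * ν) := by
      have hn : (0 : ℝ) ≤ n := Nat.cast_nonneg n
      nlinarith [mul_nonneg hn hν]
    rw [Nat.factorial_succ, Nat.cast_mul, Nat.cast_succ, one_div, mul_inv, ← one_div, ← one_div,
      div_mul_eq_mul_div, one_mul, le_div_iff₀ (by positivity), mul_comm]
    exact (mul_le_mul_of_nonneg_right hge (abs_nonneg _)).trans (h.le.trans ih)

theorem psConv_besselSeries {ν : ℝ} (hν : 0 ≤ ν) (ρ : ℝ) :
    PsConv (psOfReal (besselSeries ν)) ρ := by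
  intro x hx _
  refine Summable.of_nonneg_of_le (fun n => by positivity) (fun n => ?_)
    (Real.summable_pow_div_factorial x)
  rw [coeff_psOfReal, Complex.norm_real, Real.norm_eq_abs, div_eq_mul_one_div, mul_comm]
  exact mul_le_mul_of_nonneg_left (abs_coeff_besselSeries_le hν n) (pow_nonneg hx n)

/-- With `E = z d/dz` one has `z² d²/dz² = E² - E`, so the operator defining `N_ν` multiplies the
term `z^(ν+2n)` by `Q(ν + 2n)`. -/
theorem psOfReal_besselNSeries_coeff (a b c ν : ℝ) (hQ : besselQ a b c ν ≠ 0) (n : ℕ) :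
    besselQ a b c ν * PowerSeries.coeff n (psOfReal (besselNSeries a b c ν)) =
      a * (PowerSeries.coeff n (eulerShift ν (eulerShift ν (psOfReal (besselSeries ν)))) -
          PowerSeries.coeff n (eulerShift ν (psOfReal (besselSeries ν)))) +
        b * PowerSeries.coeff n (eulerShift ν (psOfReal (besselSeries ν))) +
        c * PowerSeries.coeff n (psOfReal (besselSeries ν)) := by
  have hQ' : (besselQ a b c ν : ℂ) ≠ 0 := by exact_mod_cast hQ
  simp only [coeff_eulerShift, coeff_psOfReal, besselNSeries, PowerSeries.coeff_mk]
  rw [Complex.ofReal_mul, Complex.ofReal_div, ← mul_assoc, mul_div_cancel₀ _ hQ']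
  unfold besselQ
  push_cast
  ring

theorem psConv_besselNSeries {a b c ν : ℝ} (hν : 0 ≤ ν) (hQ : besselQ a b c ν ≠ 0) (ρ : ℝ) :
    PsConv (psOfReal (besselNSeries a b c ν)) ρ := by
  have h0 := psConv_besselSeries hν ρ
  have h1 := h0.eulerShift ν
  have h2 := h1.eulerShift ν
  have hQ' : (besselQ a b c ν : ℂ) ≠ 0 := by exact_mod_cast hQ
  intro x hx hx'
  refine Summable.of_nonneg_of_le (fun n => by positivity) (fun n => ?_)
    ((((((h2 x hx hx').add (h1 x hx hx')).mul_left ‖(a : ℂ)‖).add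
      ((h1 x hx hx').mul_left ‖(b : ℂ)‖)).add
        ((h0 x hx hx').mul_left ‖(c : ℂ)‖)).mul_left ‖(besselQ a b c ν : ℂ)⁻¹‖)
  have := psOfReal_besselNSeries_coeff a b c ν hQ n
  rw [← eq_inv_mul_iff_mul_eq₀ hQ'] at this
  rw [this, norm_mul, mul_assoc]
  refine mul_le_mul_of_nonneg_left ?_ (norm_nonneg _)
  rw [← add_mul, ← mul_assoc, ← mul_assoc, ← mul_assoc, ← add_mul, ← add_mul]
  refine mul_le_mul_of_nonneg_right ?_ (pow_nonneg hx n)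
  refine (norm_add_le _ _).trans (add_le_add ((norm_add_le _ _).trans (add_le_add ?_ ?_)) ?_)
  · rw [norm_mul]
    exact mul_le_mul_of_nonneg_left (norm_sub_le _ _) (norm_nonneg _)
  · rw [norm_mul]
  · rw [norm_mul]

theorem besselQ_mul_psSum_besselNSeries {a b c ν : ℝ} (hν : 0 ≤ ν) (hQ : besselQ a b c ν ≠ 0)
    (w : ℂ) :
    besselQ a b c ν * psSum (psOfReal (besselNSeries a b c ν)) w =
      a * (psSum (eulerShift ν (eulerShift ν (psOfReal (besselSeries ν)))) w -
          psSum (eulerShift ν (psOfReal (besselSeries ν))) w) +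
        b * psSum (eulerShift ν (psOfReal (besselSeries ν))) w +
        c * psSum (psOfReal (besselSeries ν)) w := by
  have hw : ‖w‖ < ‖w‖ + 1 := by linarith
  have h0 := psConv_besselSeries hν (‖w‖ + 1)
  have h1 := h0.eulerShift ν
  have h2 := h1.eulerShift ν
  refine HasSum.unique (((psConv_besselNSeries hν hQ _).hasSum hw).mul_left _)
    (hasSum_congr_terms (((((h2.hasSum hw).sub (h1.hasSum hw)).mul_left _).add
      ((h1.hasSum hw).mul_left _)).add ((h0.hasSum hw).mul_left _)) fun n => ?_)
  rw [← mul_assoc, psOfReal_besselNSeries_coeff a b c ν hQ n]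
  ring

theorem besselJ_eq {ν : ℝ} (hν : 0 ≤ ν) {z : ℂ} (hz : z ≠ 0) :
    besselJ ν z = (Real.Gamma (ν + 1) : ℂ)⁻¹ *
      ((z / 2) ^ (ν : ℂ) * psSum (psOfReal (besselSeries ν)) (z ^ 2)) := by
  have hG : (Real.Gamma (ν + 1) : ℂ) ≠ 0 := by
    have := Gamma_natCast_add_pos hν 0
    rw [Nat.cast_zero, zero_add] at this
    exact_mod_cast this.ne'
  rw [besselJ, psSum, ← tsum_mul_left, ← tsum_mul_left]
  refine tsum_congr fun n => ?_
  have hz2 : z / 2 ≠ 0 := div_ne_zero hz two_ne_zero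
  have e : (z / 2) ^ (2 * (n : ℂ)) = (z ^ 2) ^ n / 4 ^ n := by
    rw [show (2 * (n : ℂ)) = ((2 * n : ℕ) : ℂ) by push_cast; ring, Complex.cpow_natCast, pow_mul,
      div_pow, div_pow]
    norm_num
  have hGn : (Real.Gamma (n + ν + 1) : ℂ) ≠ 0 := by
    exact_mod_cast (Gamma_natCast_add_pos hν n).ne'
  have hn : (n.factorial : ℂ) ≠ 0 := by exact_mod_cast n.factorial_ne_zero
  rw [Complex.cpow_add _ _ hz2, e, coeff_psOfReal, besselSeries, PowerSeries.coeff_mk]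
  simp only [Complex.ofReal_div, Complex.ofReal_mul, Complex.ofReal_pow, Complex.ofReal_neg,
    Complex.ofReal_one, Complex.ofReal_natCast, Complex.ofReal_ofNat]
  field_simp

/-- The slit plane is open and the principal power is differentiable on it, so the product formula
for `J_ν` can be differentiated twice there. -/
theorem besselN_eq {a b c ν : ℝ} (hν : 0 ≤ ν) (hQ : besselQ a b c ν ≠ 0) {z : ℂ}
    (hz : z ∈ Complex.slitPlane) :
    besselN a b c ν z = (besselQ a b c ν : ℂ) / Real.Gamma (ν + 1) *
      ((z / 2) ^ (ν : ℂ) * psSum (psOfReal (besselNSeries a b c ν)) (z ^ 2)) := by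
  have h0 := psConv_besselSeries hν
  have h1 := fun ρ => (h0 ρ).eulerShift ν
  have hJ : ∀ z ∈ Complex.slitPlane, HasDerivAt (besselJ ν) ((Real.Gamma (ν + 1) : ℂ)⁻¹ *
      ((z / 2) ^ (ν : ℂ) * psSum (eulerShift ν (psOfReal (besselSeries ν))) (z ^ 2) / z)) z := by
    intro z hz
    refine ((hasDerivAt_cpow_mul_psSum h0 ν hz).const_mul _).congr_of_eventuallyEq ?_
    filter_upwards [Complex.isOpen_slitPlane.mem_nhds hz] with y hy
    exact besselJ_eq hν (Complex.slitPlane_ne_zero hy)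
  have hz0 := Complex.slitPlane_ne_zero hz
  have hJ2 := (((hasDerivAt_cpow_mul_psSum h1 ν hz).div (hasDerivAt_id z) hz0).const_mul
    (Real.Gamma (ν + 1) : ℂ)⁻¹).congr_of_eventuallyEq (f₁ := deriv (besselJ ν)) (by
      filter_upwards [Complex.isOpen_slitPlane.mem_nhds hz] with y hy
      exact (hJ y hy).deriv)
  rw [besselN, hJ2.deriv, (hJ z hz).deriv, besselJ_eq hν hz0]
  have := besselQ_mul_psSum_besselNSeries hν hQ (z ^ 2)
  simp only [id]
  field_simp
  linear_combination -((Real.Gamma (ν + 1) : ℂ)⁻¹ * (z / 2) ^ (ν : ℂ)) * this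

theorem mul_deriv_besselN {a b c ν : ℝ} (hν : 0 ≤ ν) (hQ : besselQ a b c ν ≠ 0) {z : ℂ}
    (hz : z ∈ Complex.slitPlane) :
    z * deriv (besselN a b c ν) z = (besselQ a b c ν : ℂ) / Real.Gamma (ν + 1) *
      ((z / 2) ^ (ν : ℂ) * (ν * psSum (psOfReal (besselNSeries a b c ν)) (z ^ 2) +
        2 * (z ^ 2 * deriv (psSum (psOfReal (besselNSeries a b c ν))) (z ^ 2)))) := by
  have h := psConv_besselNSeries (c := c) hν hQ
  have hd := ((hasDerivAt_cpow_mul_psSum h ν hz).const_mul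
    ((besselQ a b c ν : ℂ) / Real.Gamma (ν + 1))).congr_of_eventuallyEq
      (f₁ := besselN a b c ν) (by
      filter_upwards [Complex.isOpen_slitPlane.mem_nhds hz] with y hy
      exact besselN_eq hν hQ hy)
  rw [hd.deriv, (h (‖z ^ 2‖ + 1)).psSum_eulerShift ν (by linarith)]
  have := Complex.slitPlane_ne_zero hz
  field_simp

/-- `z N' - (ν - t) N` in terms of the logarithmic derivative of the even part. -/
theorem mul_deriv_besselN_sub {a b c ν : ℝ} (hν : 0 ≤ ν) (hQ : besselQ a b c ν ≠ 0)
    {S : PowerSeries ℝ}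
    (hS : 2 * psEuler (besselNSeries a b c ν) = -(S * besselNSeries a b c ν)) {ρ : ℝ}
    (hSc : PsConv (psOfReal S) ρ) (t : ℂ) {z : ℂ} (hz : z ∈ Complex.slitPlane)
    (hzρ : ‖z ^ 2‖ < ρ) :
    z * deriv (besselN a b c ν) z - (ν - t) * besselN a b c ν z =
      besselN a b c ν z * (t - psSum (psOfReal S) (z ^ 2)) := by
  rw [mul_deriv_besselN hν hQ hz, besselN_eq hν hQ hz]
  have := logDeriv_relation hS (psConv_besselNSeries hν hQ ρ) hSc hzρ
  linear_combination ((besselQ a b c ν : ℂ) / Real.Gamma (ν + 1) * (z / 2) ^ (ν : ℂ)) * this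

end

/-! ### Boundary values of `φ` and the radius of `z exp(-L(z))` -/

noncomputable section

/-- If the limit were `φ(ζ)` with `|ζ| < r < 1`, the open set `φ(|z| < r)` would contain `φ(t)` for
`t` near `-1`. Injectivity then gives `|t| < r`, which fails once `t < -r`. -/
theorem radial_limit_not_mem_image {φ : ℂ → ℂ} (hφ : IsMaMinda φ) {p : ℂ}
    (h : Tendsto (fun t : ℝ => φ (t : ℂ)) (𝓝[>] (-1)) (𝓝 p)) : p ∉ φ '' Metric.ball 0 1 := by
  rintro ⟨ζ, hζ, rfl⟩
  have hζ1 : ‖ζ‖ < 1 := mem_ball_zero_iff.1 hζ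
  obtain ⟨r, hr, hr1⟩ := exists_between hζ1
  have hr0 : 0 ≤ r := (norm_nonneg ζ).trans hr.le
  have hopen : IsOpen (φ '' Metric.ball 0 r) := by
    have hsub : Metric.ball (0 : ℂ) r ⊆ Metric.ball 0 1 := Metric.ball_subset_ball hr1.le
    have han : AnalyticOnNhd ℂ φ (Metric.ball 0 r) :=
      (hφ.analytic.mono hsub).analyticOnNhd Metric.isOpen_ball
    rcases han.is_constant_or_isOpen (convex_ball 0 r).isPreconnected with ⟨w, hw⟩ | ho
    · exfalso
      have hr0' : 0 < r := (norm_nonneg ζ).trans_lt hr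
      have hm0 : (0 : ℂ) ∈ Metric.ball (0 : ℂ) r := by simpa using hr0'
      have hm1 : ((r / 2 : ℝ) : ℂ) ∈ Metric.ball (0 : ℂ) r := by
        rw [mem_ball_zero_iff, Complex.norm_real, Real.norm_of_nonneg (by positivity)]
        linarith
      have := hφ.univalent (hsub hm0) (hsub hm1) ((hw _ hm0).trans (hw _ hm1).symm)
      have : (0 : ℝ) = r / 2 := by exact_mod_cast this
      linarith
    · exact ho _ le_rfl Metric.isOpen_ball
  have hmem : φ '' Metric.ball 0 r ∈ 𝓝 (φ ζ) :=
    hopen.mem_nhds ⟨ζ, mem_ball_zero_iff.2 hr, rfl⟩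
  have hIoo : Set.Ioo (-1 : ℝ) (-r) ∈ 𝓝[>] (-1 : ℝ) := Ioo_mem_nhdsGT (by linarith)
  obtain ⟨t, ⟨z, hz, hzt⟩, ht⟩ := ((h.eventually_mem hmem).and hIoo).exists
  have hz' : ‖z‖ < r := mem_ball_zero_iff.1 hz
  have htn : ‖(t : ℂ)‖ = -t := by
    rw [Complex.norm_real, Real.norm_of_nonpos (by linarith [ht.2])]
  have hzt' := hφ.univalent (mem_ball_zero_iff.2 (hz'.trans hr1))
    (mem_ball_zero_iff.2 (by rw [htn]; linarith [ht.1])) hzt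
  rw [hzt', htn] at hz'
  linarith [ht.2]

/-- The radius of a function `z exp(-L(z))` whose starlikeness quotient is `1 - zL'(z)`. -/
theorem isStarRadius_of_exp {φ f L : ℂ → ℂ} {β ρ R : ℝ}
    (hball : Metric.ball (1 : ℂ) β ⊆ φ '' Metric.ball 0 1)
    (hβ : ((1 - β : ℝ) : ℂ) ∉ φ '' Metric.ball 0 1)
    (hL : DifferentiableOn ℂ L (Metric.ball 0 ρ)) (hL0 : L 0 = 0)
    (hf : ∀ᶠ x : ℝ in 𝓝[>] 0, f x = x * Complex.exp (-L x)) (hR : 0 < R) (hRρ : R < ρ)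
    (hlt : ∀ z : ℂ, ‖z‖ < R → ‖z * deriv L z‖ < β) (heq : R * deriv L R = β) :
    IsStarRadius φ f R := by
  set F : ℂ → ℂ := fun z => z * Complex.exp (-L z) with hF
  have hFd : DifferentiableOn ℂ F (Metric.ball 0 ρ) := differentiableOn_id.mul hL.neg.cexp
  have hder : ∀ z : ℂ, ‖z‖ < ρ →
      HasDerivAt F (Complex.exp (-L z) * (1 - z * deriv L z)) z := by
    intro z hz
    have hLz :=
      (hL.differentiableAt (Metric.isOpen_ball.mem_nhds (mem_ball_zero_iff.2 hz))).hasDerivAt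
    refine ((hasDerivAt_id z).mul hLz.neg.cexp).congr_deriv ?_
    simp only [id, Pi.neg_apply]
    ring
  have hquot : ∀ z : ℂ, ‖z‖ < ρ → z ≠ 0 → F z ≠ 0 ∧ z * deriv F z / F z = 1 - z * deriv L z := by
    intro z hz hz0
    have he := Complex.exp_ne_zero (-L z)
    refine ⟨mul_ne_zero hz0 he, ?_⟩
    rw [(hder z hz).deriv, hF]
    field_simp
  refine IsGreatest.isLUB ⟨⟨hR, F, ⟨hFd.mono (Metric.ball_subset_ball hRρ.le), by simp [hF], ?_,
    hf.mono fun x hx => hx.symm⟩, ?_⟩, ?_⟩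
  · rw [(hder 0 (by simpa using hR.trans hRρ)).deriv, hL0]
    simp
  · intro z hz hz0
    have hz' := mem_ball_zero_iff.1 hz
    obtain ⟨h1, h2⟩ := hquot z (hz'.trans hRρ) hz0
    refine ⟨h1, hball ?_⟩
    rw [h2, Metric.mem_ball, dist_eq_norm, sub_sub_cancel_left, norm_neg]
    exact hlt z hz'
  -- A competitor `G` on a larger disk agrees with `F` for small positive `x`, hence on the disk of
  -- radius `min r ρ` by the identity theorem. This disk contains `R`, where the quotient is the
  -- excluded value `1 - β`.
  · rintro r ⟨hr, G, hG, hstar⟩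
    by_contra! hRr
    have hm : 0 < min r ρ := lt_min hr (hR.trans hRρ)
    have hRm : R < min r ρ := lt_min hRr hRρ
    have hGa : AnalyticOnNhd ℂ G (Metric.ball 0 (min r ρ)) :=
      (hG.analytic.mono (Metric.ball_subset_ball (min_le_left _ _))).analyticOnNhd
        Metric.isOpen_ball
    have hFa : AnalyticOnNhd ℂ F (Metric.ball 0 (min r ρ)) :=
      (hFd.mono (Metric.ball_subset_ball (min_le_right _ _))).analyticOnNhd Metric.isOpen_ball
    have hfreq : ∃ᶠ z in 𝓝[≠] (0 : ℂ), G z = F z := by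
      have hev : ∀ᶠ x : ℝ in 𝓝[>] 0, G x = F x := by
        filter_upwards [hG.eq_formula, hf] with x h1 h2
        rw [h1, h2]
      have htend : Tendsto (fun x : ℝ => (x : ℂ)) (𝓝[>] 0) (𝓝[≠] 0) := by
        refine tendsto_nhdsWithin_iff.2 ⟨?_, ?_⟩
        · have := (Complex.continuous_ofReal.tendsto 0).mono_left
            (nhdsWithin_le_nhds (s := Set.Ioi 0))
          simpa using this
        · filter_upwards [self_mem_nhdsWithin] with x hx
          simpa using (ne_of_gt hx : x ≠ 0)
      exact htend.frequently hev.frequently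
    have heqOn := hGa.eqOn_of_preconnected_of_frequently_eq hFa (convex_ball 0 _).isPreconnected
      (Metric.mem_ball_self hm) hfreq
    have hRn : ‖(R : ℂ)‖ = R := by rw [Complex.norm_real, Real.norm_of_nonneg hR.le]
    have hRmem : (R : ℂ) ∈ Metric.ball (0 : ℂ) (min r ρ) := by
      rw [mem_ball_zero_iff, hRn]; exact hRm
    have hR0 : (R : ℂ) ≠ 0 := by exact_mod_cast hR.ne'
    have hderiv : deriv G R = deriv F R :=
      (heqOn.eventuallyEq_of_mem (Metric.isOpen_ball.mem_nhds hRmem)).deriv_eq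
    have hin := (hstar R (by rw [mem_ball_zero_iff, hRn]; exact hRr) hR0).2
    rw [hderiv, heqOn hRmem, (hquot R (by rw [hRn]; exact hRρ) hR0).2, heq] at hin
    exact hβ (by simpa using hin)

end

/-! ### The first zero of `N_ν`, the root equations and the three normalizations -/

noncomputable section

theorem Gamma_add_one_pos {ν : ℝ} (hν : 0 ≤ ν) : 0 < Real.Gamma (ν + 1) :=
  Real.Gamma_pos_of_pos (by positivity)

theorem ofReal_mem_slitPlane_of_pos {x : ℝ} (hx : 0 < x) : (x : ℂ) ∈ Complex.slitPlane :=
  Complex.ofReal_mem_slitPlane.2 hx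

theorem ofReal_div_two_cpow_ne_zero {x : ℝ} (hx : 0 < x) (ν : ℝ) :
    ((x : ℂ) / 2) ^ (ν : ℂ) ≠ 0 := by
  rw [Complex.cpow_ne_zero_iff]
  left
  exact div_ne_zero (by exact_mod_cast hx.ne') two_ne_zero

theorem besselN_ofReal_eq_zero_iff {a b c ν : ℝ} (hν : 0 ≤ ν) (hQ : besselQ a b c ν ≠ 0) {x : ℝ}
    (hx : 0 < x) :
    besselN a b c ν x = 0 ↔ psSum (psOfReal (besselNSeries a b c ν)) ((x ^ 2 : ℝ) : ℂ) = 0 := by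
  rw [besselN_eq hν hQ (ofReal_mem_slitPlane_of_pos hx), Complex.ofReal_pow]
  have h1 : (besselQ a b c ν : ℂ) ≠ 0 := by exact_mod_cast hQ
  have h2 : (Real.Gamma (ν + 1) : ℂ) ≠ 0 := by exact_mod_cast (Gamma_add_one_pos hν).ne'
  have h3 := ofReal_div_two_cpow_ne_zero hx ν
  simp [h1, h2, h3]

/-- For `x > 0`, `2^ν Γ(ν+1)/Q(ν) · N_ν(x) = x^ν v(x²)`. -/
theorem normalized_besselN_ofReal {a b c ν : ℝ} (hν : 0 ≤ ν) (hQ : besselQ a b c ν ≠ 0) {x : ℝ}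
    (hx : 0 < x) :
    (2 : ℂ) ^ (ν : ℂ) * (Real.Gamma (ν + 1) : ℂ) / (besselQ a b c ν : ℂ) * besselN a b c ν x =
      ((x ^ ν : ℝ) : ℂ) * psSum (psOfReal (besselNSeries a b c ν)) ((x ^ 2 : ℝ) : ℂ) := by
  rw [besselN_eq hν hQ (ofReal_mem_slitPlane_of_pos hx), Complex.ofReal_cpow hx.le,
    Complex.ofReal_pow]
  have h1 : (besselQ a b c ν : ℂ) ≠ 0 := by exact_mod_cast hQ
  have h2 : (Real.Gamma (ν + 1) : ℂ) ≠ 0 := by exact_mod_cast (Gamma_add_one_pos hν).ne'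
  have h3 : (x : ℂ) ^ (ν : ℂ) = 2 ^ (ν : ℂ) * ((x : ℂ) / 2) ^ (ν : ℂ) := by
    have := Complex.mul_cpow_ofReal_nonneg (a := 2) (b := x / 2) (by norm_num) (by positivity) ν
    push_cast at this
    rw [← this, mul_div_cancel₀ _ two_ne_zero]
  rw [h3]
  field_simp

theorem norm_ofReal_sq_lt {x x₀ : ℝ} (hx : 0 ≤ x)
    (hxl : x < Real.sqrt x₀) : ‖((x ^ 2 : ℝ) : ℂ)‖ < x₀ := by
  rw [Complex.norm_real, Real.norm_of_nonneg (sq_nonneg x)]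
  exact (Real.lt_sqrt hx).1 hxl

/-- `S` is the Taylor series of `-2wv'/v`, where `v` is the even part of `N_ν` (as a function of
`w = z²`), its coefficients are nonnegative, and `x₀` is the first zero of `v`. -/
structure IsBesselNData (a b c ν : ℝ) (S : PowerSeries ℝ) (x₀ : ℝ) : Prop where
  nonneg : 0 ≤ ν
  Q_ne_zero : besselQ a b c ν ≠ 0
  logDeriv : 2 * psEuler (besselNSeries a b c ν) = -(S * besselNSeries a b c ν)
  coeff_nonneg : ∀ n, 0 ≤ PowerSeries.coeff n S
  coeff_zero : PowerSeries.coeff 0 S = 0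
  coeff_one_pos : 0 < PowerSeries.coeff 1 S
  pos : 0 < x₀
  zero : psSum (psOfReal (besselNSeries a b c ν)) x₀ = 0
  ne_zero : ∀ w : ℂ, ‖w‖ < x₀ → psSum (psOfReal (besselNSeries a b c ν)) w ≠ 0

theorem exists_isBesselNData {a b c ν : ℝ}
    (habc : (c = 0 ∧ a ≠ b) ∨ (0 < c ∧ a < b)) (hν : 0 ≤ ν)
    (hν₀ : ∀ x : ℝ, besselQ a b c x = 0 → x ≤ ν) (hQ : besselQ a b c ν ≠ 0) :
    ∃ S x₀, IsBesselNData a b c ν S x₀ := by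
  obtain ⟨S, hS, A, q, hA, hq, hAq⟩ := exists_logDeriv_besselNSeries habc hν hν₀ hQ
  have hV0 := coeff_zero_besselNSeries hν hQ
  have hS0 : PowerSeries.coeff 0 S = 0 := by
    have := congrArg (PowerSeries.coeff 0) hS
    rw [coeff_two_mul, coeff_psEuler, map_neg, coeff_zero_mul_eq, hV0] at this
    simpa using this.symm
  have hSnn : ∀ n, 0 ≤ PowerSeries.coeff n S := by
    intro n
    rcases Nat.eq_zero_or_pos n with rfl | h
    · rw [hS0]
    · exact le_trans (by positivity) (hAq n h)
  obtain ⟨x₀, hx₀, hzero, hne⟩ :=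
    exists_first_zero hS hV0 (psConv_besselNSeries hν hQ) hSnn hS0 hA hq hAq
  exact ⟨S, x₀, hν, hQ, hS, hSnn, hS0, lt_of_lt_of_le (by positivity) (hAq 1 le_rfl), hx₀, hzero,
    hne⟩

namespace IsBesselNData

variable {a b c ν x₀ : ℝ} {S : PowerSeries ℝ}

theorem psConv (h : IsBesselNData a b c ν S x₀) : PsConv (psOfReal S) x₀ :=
  psConv_logDeriv_of_ne_zero h.logDeriv (coeff_zero_besselNSeries h.nonneg h.Q_ne_zero)
    (psConv_besselNSeries h.nonneg h.Q_ne_zero x₀) h.ne_zero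

theorem isLeast_zero (h : IsBesselNData a b c ν S x₀) :
    IsLeast {x : ℝ | 0 < x ∧ besselN a b c ν (x : ℂ) = 0} (Real.sqrt x₀) := by
  have hpos := Real.sqrt_pos.2 h.pos
  refine ⟨⟨hpos, ?_⟩, fun x ⟨hx, hx0⟩ => ?_⟩
  · rw [besselN_ofReal_eq_zero_iff h.nonneg h.Q_ne_zero hpos, Real.sq_sqrt h.pos.le]
    exact h.zero
  · by_contra! hlt
    rw [besselN_ofReal_eq_zero_iff h.nonneg h.Q_ne_zero hx] at hx0
    exact h.ne_zero _ (norm_ofReal_sq_lt hx.le hlt) hx0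

theorem exists_eq (h : IsBesselNData a b c ν S x₀) {t : ℝ} (ht : 0 < t) :
    ∃ x : ℝ, 0 < x ∧ x < x₀ ∧ psSum (psOfReal S) x = t ∧
      ∀ w : ℂ, ‖w‖ < x → ‖psSum (psOfReal S) w‖ < t :=
  exists_logDeriv_eq h.logDeriv (coeff_zero_besselNSeries h.nonneg h.Q_ne_zero)
    (psConv_besselNSeries h.nonneg h.Q_ne_zero) h.coeff_nonneg h.coeff_zero h.coeff_one_pos h.pos
    h.zero h.ne_zero ht

/-- Below the first zero of `N_ν` the left side factors as `N_ν(r)(t - S(r²))`. The first factor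
does not vanish there, and the second vanishes for the first time at `r² = x`. -/
theorem isLeast_root (h : IsBesselNData a b c ν S x₀) {t x : ℝ} (hx : 0 < x) (hxx₀ : x < x₀)
    (hxt : psSum (psOfReal S) x = t) (hlt : ∀ w : ℂ, ‖w‖ < x → ‖psSum (psOfReal S) w‖ < t) :
    IsLeast {r : ℝ | 0 < r ∧ (r : ℂ) * deriv (besselN a b c ν) r -
      ((ν : ℂ) - t) * besselN a b c ν r = 0} (Real.sqrt x) := by
  have key : ∀ r : ℝ, 0 < r → r < Real.sqrt x₀ → (r : ℂ) * deriv (besselN a b c ν) r -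
      ((ν : ℂ) - t) * besselN a b c ν r =
        besselN a b c ν r * (t - psSum (psOfReal S) ((r ^ 2 : ℝ) : ℂ)) := by
    intro r hr hrl
    have hn := norm_ofReal_sq_lt hr.le hrl
    rw [Complex.ofReal_pow] at hn ⊢
    exact mul_deriv_besselN_sub h.nonneg h.Q_ne_zero h.logDeriv h.psConv t
      (ofReal_mem_slitPlane_of_pos hr) hn
  have hxs := Real.sqrt_lt_sqrt hx.le hxx₀
  refine ⟨⟨Real.sqrt_pos.2 hx, ?_⟩, fun r ⟨hr, hr0⟩ => ?_⟩
  · rw [key _ (Real.sqrt_pos.2 hx) hxs, Real.sq_sqrt hx.le, hxt, sub_self, mul_zero]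
  · by_contra! hrx
    rw [key r hr (hrx.trans hxs)] at hr0
    rcases mul_eq_zero.1 hr0 with h0 | h0
    · exact absurd (h.isLeast_zero.2 ⟨hr, h0⟩) (not_le.2 (hrx.trans hxs))
    · have hn := hlt ((r ^ 2 : ℝ) : ℂ) (by
        rw [Complex.norm_real, Real.norm_of_nonneg (sq_nonneg r)]
        exact (Real.lt_sqrt hr.le).1 hrx)
      rw [← sub_eq_zero.1 h0, Complex.norm_real] at hn
      exact absurd (Real.le_norm_self t) (not_le.2 hn)

/-- The logarithm of `1/v` below the first zero. -/
theorem differentiableOn_log (h : IsBesselNData a b c ν S x₀) :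
    DifferentiableOn ℂ (psSum (psOfReal (psLogIntegral S))) (Metric.ball 0 x₀) :=
  (PsConv.psLogIntegral h.coeff_nonneg h.psConv).differentiableOn

theorem log_zero (h : IsBesselNData a b c ν S x₀) :
    psSum (psOfReal (psLogIntegral S)) 0 = 0 := by
  rw [psSum_zero_right, coeff_psOfReal, psLogIntegral, PowerSeries.coeff_mk, h.coeff_zero]
  simp

theorem normalized_eq (h : IsBesselNData a b c ν S x₀) {x : ℝ} (hx : 0 < x)
    (hxl : x < Real.sqrt x₀) :
    (2 : ℂ) ^ (ν : ℂ) * (Real.Gamma (ν + 1) : ℂ) / (besselQ a b c ν : ℂ) * besselN a b c ν x =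
      ((x ^ ν : ℝ) : ℂ) *
        Complex.exp (-psSum (psOfReal (psLogIntegral S)) ((x ^ 2 : ℝ) : ℂ)) := by
  rw [normalized_besselN_ofReal h.nonneg h.Q_ne_zero hx,
    psSum_eq_exp_psLogIntegral h.logDeriv (coeff_zero_besselNSeries h.nonneg h.Q_ne_zero)
      h.coeff_nonneg h.coeff_zero (psConv_besselNSeries h.nonneg h.Q_ne_zero x₀) h.psConv
      (norm_ofReal_sq_lt hx.le hxl)]

theorem fNormal_eq (h : IsBesselNData a b c ν S x₀) (hν : ν ≠ 0) {x : ℝ} (hx : 0 < x)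
    (hxl : x < Real.sqrt x₀) :
    fNormal a b c ν x =
      x * Complex.exp (-(psSum (psOfReal (psLogIntegral S)) ((x : ℂ) ^ 2) / ν)) := by
  rw [fNormal, h.normalized_eq hx hxl, ← Complex.ofReal_pow, psSum_psOfReal_ofReal]
  -- The base of the power is the positive real `x^ν e^(-τ)`, so the principal power is the real one
  -- and splits over the product.
  set τ : ℝ := ∑' n, PowerSeries.coeff n (psLogIntegral S) * (x ^ 2) ^ n
  rw [show (1 / (ν : ℂ)) = ((1 / ν : ℝ) : ℂ) by push_cast; rfl, ← Complex.ofReal_neg,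
    ← Complex.ofReal_exp, ← Complex.ofReal_mul, ← Complex.ofReal_cpow (by positivity),
    Real.mul_rpow (by positivity) (by positivity), ← Real.rpow_mul hx.le,
    mul_one_div_cancel hν, Real.rpow_one, ← Real.exp_mul]
  push_cast
  congr 2
  ring

theorem gNormal_eq (h : IsBesselNData a b c ν S x₀) {x : ℝ} (hx : 0 < x)
    (hxl : x < Real.sqrt x₀) :
    gNormal a b c ν x =
      x * Complex.exp (-(psSum (psOfReal (psLogIntegral S)) ((x : ℂ) ^ 2))) := by
  have hx0 : (x : ℂ) ≠ 0 := by exact_mod_cast hx.ne'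
  have e : gNormal a b c ν x = (x : ℂ) ^ (1 - (ν : ℂ)) *
      ((2 : ℂ) ^ (ν : ℂ) * (Real.Gamma (ν + 1) : ℂ) / (besselQ a b c ν : ℂ) *
        besselN a b c ν x) := by
    rw [gNormal]; ring
  rw [e, h.normalized_eq hx hxl, Complex.ofReal_cpow hx.le, ← mul_assoc,
    ← Complex.cpow_add _ _ hx0, sub_add_cancel, Complex.cpow_one, Complex.ofReal_pow]

theorem hNormal_eq (h : IsBesselNData a b c ν S x₀) {x : ℝ} (hx : 0 < x) (hxl : x < x₀) :
    hNormal a b c ν x = x * Complex.exp (-(psSum (psOfReal (psLogIntegral S)) (x : ℂ))) := by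
  have hx0 : (x : ℂ) ≠ 0 := by exact_mod_cast hx.ne'
  have hs : (x : ℂ) ^ (1 / 2 : ℂ) = (Real.sqrt x : ℝ) := by
    rw [Real.sqrt_eq_rpow, Complex.ofReal_cpow hx.le]
    push_cast; rfl
  have e : hNormal a b c ν x = (x : ℂ) ^ (1 - (ν : ℂ) / 2) *
      ((2 : ℂ) ^ (ν : ℂ) * (Real.Gamma (ν + 1) : ℂ) / (besselQ a b c ν : ℂ) *
        besselN a b c ν (Real.sqrt x : ℝ)) := by
    rw [hNormal, hs]; ring
  have hp : (((Real.sqrt x) ^ ν : ℝ) : ℂ) = (x : ℂ) ^ ((ν : ℂ) / 2) := by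
    rw [Real.sqrt_eq_rpow, ← Real.rpow_mul hx.le, Complex.ofReal_cpow hx.le]
    congr 1
    push_cast; ring
  rw [e, h.normalized_eq (Real.sqrt_pos.2 hx) (Real.sqrt_lt_sqrt hx.le hxl), hp,
    Real.sq_sqrt hx.le, ← mul_assoc, ← Complex.cpow_add _ _ hx0, sub_add_cancel, Complex.cpow_one]

/-- The radius of `z v(z²)^(1/κ)`. -/
theorem isStarRadius_sq (h : IsBesselNData a b c ν S x₀) {κ β x : ℝ} {φ f : ℂ → ℂ} (hκ : 0 < κ)
    (hball : Metric.ball (1 : ℂ) β ⊆ φ '' Metric.ball 0 1)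
    (hβ : ((1 - β : ℝ) : ℂ) ∉ φ '' Metric.ball 0 1)
    (hf : ∀ x : ℝ, 0 < x → x < Real.sqrt x₀ → f x =
      x * Complex.exp (-(psSum (psOfReal (psLogIntegral S)) ((x : ℂ) ^ 2) / κ)))
    (hx : 0 < x) (hxx₀ : x < x₀) (hxt : psSum (psOfReal S) x = (β * κ : ℝ))
    (hlt : ∀ w : ℂ, ‖w‖ < x → ‖psSum (psOfReal S) w‖ < β * κ) :
    IsStarRadius φ f (Real.sqrt x) := by
  have hsq : ∀ {y : ℝ} {z : ℂ}, ‖z‖ < Real.sqrt y → ‖z ^ 2‖ < y := fun {y z} hz => by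
    rw [norm_pow]
    exact (Real.lt_sqrt (norm_nonneg z)).1 hz
  have hκ' : (κ : ℂ) ≠ 0 := by exact_mod_cast hκ.ne'
  have hd : ∀ z : ℂ, ‖z‖ < Real.sqrt x₀ →
      HasDerivAt (fun z => psSum (psOfReal (psLogIntegral S)) (z ^ 2) / κ)
        (deriv (psSum (psOfReal (psLogIntegral S))) (z ^ 2) * (2 * z) / κ) z := by
    intro z hz
    have h1 := (h.differentiableOn_log.differentiableAt
      (Metric.isOpen_ball.mem_nhds (mem_ball_zero_iff.2 (hsq hz)))).hasDerivAt
    have := (h1.comp z (hasDerivAt_pow 2 z)).div_const (κ : ℂ)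
    simpa [Function.comp_def] using this
  have hzd : ∀ z : ℂ, ‖z‖ < Real.sqrt x₀ →
      z * deriv (fun z => psSum (psOfReal (psLogIntegral S)) (z ^ 2) / κ) z =
        psSum (psOfReal S) (z ^ 2) / κ := by
    intro z hz
    rw [(hd z hz).deriv, ← mul_deriv_psLogIntegral h.coeff_nonneg h.coeff_zero h.psConv (hsq hz)]
    ring
  have hs := Real.sqrt_lt_sqrt hx.le hxx₀
  refine isStarRadius_of_exp (ρ := Real.sqrt x₀)
    (L := fun z => psSum (psOfReal (psLogIntegral S)) (z ^ 2) / κ) hball hβ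
    (fun z hz => (hd z (mem_ball_zero_iff.1 hz)).differentiableAt.differentiableWithinAt)
    (by simp [h.log_zero]) ?_ (Real.sqrt_pos.2 hx) hs (fun z hz => ?_) ?_
  · filter_upwards [Ioo_mem_nhdsGT (Real.sqrt_pos.2 h.pos)] with y hy
    exact hf y hy.1 hy.2
  · rw [hzd z (hz.trans hs), norm_div, Complex.norm_real, Real.norm_of_nonneg hκ.le,
      div_lt_iff₀ hκ]
    exact hlt _ (hsq hz)
  · rw [hzd _ (by rwa [Complex.norm_real, Real.norm_of_nonneg (Real.sqrt_nonneg x)]),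
      ← Complex.ofReal_pow, Real.sq_sqrt hx.le, hxt, Complex.ofReal_mul, mul_div_cancel_right₀ _ hκ']

/-- The radius of `z v(z)`. -/
theorem isStarRadius_id (h : IsBesselNData a b c ν S x₀) {β x : ℝ} {φ f : ℂ → ℂ}
    (hball : Metric.ball (1 : ℂ) β ⊆ φ '' Metric.ball 0 1)
    (hβ : ((1 - β : ℝ) : ℂ) ∉ φ '' Metric.ball 0 1)
    (hf : ∀ x : ℝ, 0 < x → x < x₀ → f x =
      x * Complex.exp (-(psSum (psOfReal (psLogIntegral S)) (x : ℂ))))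
    (hx : 0 < x) (hxx₀ : x < x₀) (hxt : psSum (psOfReal S) x = (2 * β : ℝ))
    (hlt : ∀ w : ℂ, ‖w‖ < x → ‖psSum (psOfReal S) w‖ < 2 * β) :
    IsStarRadius φ f x := by
  have hzd := fun {z : ℂ} (hz : ‖z‖ < x₀) =>
    mul_deriv_psLogIntegral h.coeff_nonneg h.coeff_zero h.psConv hz
  refine isStarRadius_of_exp (ρ := x₀) (L := psSum (psOfReal (psLogIntegral S))) hball hβ
    h.differentiableOn_log h.log_zero ?_ hx hxx₀ (fun z hz => ?_) ?_
  · filter_upwards [Ioo_mem_nhdsGT h.pos] with y hy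
    exact hf y hy.1 hy.2
  · have := hlt z hz
    rw [← hzd (hz.trans hxx₀), norm_mul, Complex.norm_two] at this
    linarith
  · have := hzd (z := x) (by rwa [Complex.norm_real, Real.norm_of_nonneg hx.le])
    rw [hxt] at this
    push_cast at this
    linear_combination this / 2

end IsBesselNData

end

theorem theorem3 (a b c ν β : ℝ) (φ : ℂ → ℂ)
    (habc : (c = 0 ∧ a ≠ b) ∨ (0 < c ∧ a < b))
    (hν : 0 ≤ ν)
    (hν₀ : ∀ x : ℝ, besselQ a b c x = 0 → x ≤ ν)
    (hQ : besselQ a b c ν ≠ 0)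
    (hφ : IsMaMinda φ)
    (hβ : IsGreatest {ρ : ℝ | 0 < ρ ∧ Metric.ball (1 : ℂ) ρ ⊆ φ '' Metric.ball 0 1} β)
    (hφβ : Tendsto (fun t : ℝ => φ (t : ℂ)) (𝓝[>] (-1)) (𝓝 ((1 - β : ℝ) : ℂ))) :
    ∃ l : ℝ, IsLeast {x : ℝ | 0 < x ∧ besselN a b c ν (x : ℂ) = 0} l ∧
      (ν ≠ 0 → ∃ R : ℝ,
        IsLeast {r : ℝ | 0 < r ∧ (r : ℂ) * deriv (besselN a b c ν) (r : ℂ) -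
          (1 - (β : ℂ)) * (ν : ℂ) * besselN a b c ν (r : ℂ) = 0} R ∧
        R < l ∧ IsStarRadius φ (fNormal a b c ν) R) ∧
      (∃ R : ℝ,
        IsLeast {r : ℝ | 0 < r ∧ (r : ℂ) * deriv (besselN a b c ν) (r : ℂ) -
          ((ν : ℂ) - (β : ℂ)) * besselN a b c ν (r : ℂ) = 0} R ∧
        R < l ∧ IsStarRadius φ (gNormal a b c ν) R) ∧
      (∃ R : ℝ,
        IsLeast {r : ℝ | 0 < r ∧ (Real.sqrt r : ℂ) * deriv (besselN a b c ν) (Real.sqrt r : ℂ) -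
          ((ν : ℂ) - 2 * (β : ℂ)) * besselN a b c ν (Real.sqrt r : ℂ) = 0} R ∧
        R < l ^ 2 ∧ IsStarRadius φ (hNormal a b c ν) R) := by

  obtain ⟨hβpos, hball⟩ := hβ.1
  have hβmem := radial_limit_not_mem_image hφ hφβ
  obtain ⟨S, x₀, h⟩ := exists_isBesselNData habc hν hν₀ hQ
  refine ⟨Real.sqrt x₀, h.isLeast_zero, fun hν0 => ?_, ?_, ?_⟩
  · have hνpos : 0 < ν := lt_of_le_of_ne hν (Ne.symm hν0)
    -- `|S(z²)/ν| < β` is the starlikeness bound for `f_ν`, so the threshold for `S` is `βν`. For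
    -- `g_ν` and `h_ν` the quotients `1 - S(z²)` and `1 - S(z)/2` give `β` and `2β`.
    obtain ⟨x, hx, hxx₀, hxt, hlt⟩ := h.exists_eq (mul_pos hβpos hνpos)
    refine ⟨Real.sqrt x, ?_, Real.sqrt_lt_sqrt hx.le hxx₀,
      h.isStarRadius_sq hνpos hball hβmem (fun y hy hyl => h.fNormal_eq hν0 hy hyl) hx hxx₀ hxt hlt⟩
    have := h.isLeast_root hx hxx₀ hxt hlt
    rwa [show (ν : ℂ) - ((β * ν : ℝ) : ℂ) = (1 - (β : ℂ)) * ν by push_cast; ring] at this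
  · obtain ⟨x, hx, hxx₀, hxt, hlt⟩ := h.exists_eq hβpos
    refine ⟨Real.sqrt x, h.isLeast_root hx hxx₀ hxt hlt, Real.sqrt_lt_sqrt hx.le hxx₀,
      h.isStarRadius_sq one_pos hball hβmem (fun y hy hyl => ?_) hx hxx₀ (by rwa [mul_one])
        (by rwa [mul_one])⟩
    rw [h.gNormal_eq hy hyl, Complex.ofReal_one, div_one]
  · obtain ⟨x, hx, hxx₀, hxt, hlt⟩ := h.exists_eq (mul_pos two_pos hβpos)
    have hroot := h.isLeast_root hx hxx₀ hxt hlt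
    rw [Complex.ofReal_mul, Complex.ofReal_ofNat] at hroot
    refine ⟨x, ⟨⟨hx, hroot.1.2⟩, fun r ⟨hr, hr0⟩ => ?_⟩, by rwa [Real.sq_sqrt h.pos.le],
      h.isStarRadius_id hball hβmem (fun y hy hyl => h.hNormal_eq hy hyl) hx hxx₀ hxt hlt⟩
    -- Equation (c) is the root equation with `t = 2β` at the point `√r`, so minimality transfers
    -- through the square root.
    exact (Real.sqrt_le_sqrt_iff hr.le).1 (hroot.2 ⟨Real.sqrt_pos.2 hr, hr0⟩)
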